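/- Conventions. Let $\mathbb S=\{I\in\mathbb H: I^2=-1\}$ and $x+y\mathbb S=\{x+Iy: I\in\mathbb S\}$. A domain $\Omega\subseteq\mathbb H$ is a \emph{symmetric slice domain} if it meets $\mathbb R$, if $\Omega\cap(\mathbb R+I\mathbb R)$ is a domain of $\mathbb R+I\mathbb R$ for all $I\in\mathbb S$, and if $\Omega$ contains $x+y\mathbb S$ whenever it contains a point of it. A function $f:\Omega\to\mathbb H$ is (slice) \emph{regular} if for each $I\in\mathbb S$ its restriction $f_I$ to $\Omega\cap(\mathbb R+I\mathbb R)$ is $C^1$ with $\left(\frac{\partial}{\partial x}+I\frac{\partial}{\partial y}\right)f_I(x+Iy)=0$. The symbols $*$, $f^{*n}$ and $f^{-*}=\frac1{f^s}f^c$ denote the $*$-product, the $*$-power and the regular reciprocal of regular functions, where $f^c$ is the regular conjugate and $f^s=f*f^c$. Explicitly, if $f(x+Iy)=\alpha+I\beta$ and $g(x+Iy)=\gamma+I\delta$ for all $I\in\mathbb S$, then $(f*g)(x+Iy)=(\alpha\gamma-\beta\delta)+I(\alpha\delta+\beta\gamma)$ and $f^c(x+Iy)=\bar\alpha+I\bar\beta$.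 A regular function $f$ on $\Omega'$ has a \emph{pole} at $p$ if it has a Laurent expansion $f(q)=\sum_{k\in\mathbb Z}(q-p)^{*k}a_k$ on some $\Sigma(p,0,R)\subseteq\Omega'$, $R>0$, with $a_{-k}=0$ for all $k>m$, for some $m\in\mathbb N$; the least such $m$ is the order $ord_f(p)$ (poles of order $0$ are allowed). Here $\Sigma(p,0,R)=\{q:\tau(q,p)>0,\ \sigma(q,p)<R\}$, where $\sigma(q,p)=\tau(q,p)=|q-p|$ if $p,q$ lie on a common line $\mathbb R+I\mathbb R$, and otherwise $\sigma(q,p)$, $\tau(q,p)$ equal $\sqrt{(\mathrm{Re}\,q-\mathrm{Re}\,p)^2+(|\mathrm{Im}\,q|\pm|\mathrm{Im}\,p|)^2}$ with sign $+$, $-$ respectively. A function $f$ is \emph{semiregular} in a symmetric slice domain $\Omega$ if it is regular in a symmetric slice domain $\Omega'\subseteq\Omega$ and each point of $\Omega\setminus\Omega'$ is a pole or a removable singularity of $f$ (that is, a point $p$ with $\Sigma(p,0,R)\subseteq\Omega'$ for some $R>0$ such that $f$ extends to a neighborhood of $p$ as a regular function). Theorem. Let $f$ be semiregular in a symmetric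 slice domain $\Omega$, with domain of regularity $\Omega'$ as above. Let $p=x+yI\in\Omega$ with $x,y\in\mathbb R$, $I\in\mathbb S$. Then $m=ord_f(p)$ and $n=ord_f(\bar p)$ are finite. Suppose $m\le n$. (1) There exist a symmetric slice domain $U$ with $p\in U\subseteq\Omega$ and $U\setminus(x+y\mathbb S)\subseteq\Omega'$, and a regular function $g:U\to\mathbb H$, such that $$f(q)=[(q-p)^{*m}*(q-\bar p)^{*n}]^{-*}*g(q)=\left[(q-x)^2+y^2\right]^{-n}(q-p)^{*(n-m)}*g(q)$$ for all $q\in U\setminus(x+y\mathbb S)$; moreover $g$ is the unique regular function on $U$ for which the first equality holds there. (2) There exists a semiregular function $g$ in $\Omega$, regular on the symmetric slice domain $\Omega'\cup(x+y\mathbb S)$ (in particular without poles of positive order in $x+y\mathbb S$), such that the same two equalities hold on $\Omega'\setminus(x+y\mathbb S)$. It is unique: every semiregular function in $\Omega$ for which the first equality holds, off $x+y\mathbb S$, wherever it and $f$ are both regular, coincides with $g$ on the common domain of regularity. In both (1) and (2), if $y\ne0$ and $n>0$, then $g(\bar p)\neq0$; moreover $g(p)\ne0$ except possibly when $m=0$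 and $f(z)\to0$ as $z\to p$ in $(\mathbb R+I\mathbb R)\setminus\{p\}$. -/

import Mathlib

open scoped Quaternion
open Set Filter Topology

namespace SliceRegular

noncomputable section

/-! ### Slices, spheres and domains -/

/-- The 2-sphere of imaginary units of the quaternions. -/
def imagUnits : Set ℍ[ℝ] := {I | I ^ 2 = -1}

/-- The complex line `ℝ + Iℝ`. -/
def slice (I : ℍ[ℝ]) : Set ℍ[ℝ] := {q | ∃ x y : ℝ, q = (x : ℍ[ℝ]) + I * (y : ℍ[ℝ])}

/-- The sphere `x + y𝕊` (a single real point when `y = 0`). -/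
def sphere (x y : ℝ) : Set ℍ[ℝ] := {q | ∃ I ∈ imagUnits, q = (x : ℍ[ℝ]) + I * (y : ℍ[ℝ])}

/-- Axially symmetric sets. -/
def IsAxiallySymmetric (T : Set ℍ[ℝ]) : Prop :=
  ∀ x y : ℝ, ∀ I ∈ imagUnits, (x : ℍ[ℝ]) + I * (y : ℍ[ℝ]) ∈ T → sphere x y ⊆ T

/-- Slice domains: domains of `ℍ` that meet the real axis and whose intersection with every
complex line `ℝ + Iℝ` is a domain of that line (it is automatically open there). -/
structure IsSliceDomain (Ω : Set ℍ[ℝ]) : Prop where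
  isOpen : IsOpen Ω
  isConnected : IsConnected Ω
  meets_real : ∃ r : ℝ, (r : ℍ[ℝ]) ∈ Ω
  slice_connected : ∀ I ∈ imagUnits, IsConnected (Ω ∩ slice I)

structure IsSymmetricSliceDomain (Ω : Set ℍ[ℝ]) : Prop extends IsSliceDomain Ω where
  symmetric : IsAxiallySymmetric Ω

/-! ### Regular functions

A function on `Ω` is represented by a total function of which only the values on `Ω` are used. -/

/-- The restriction of `f` to the line `ℝ + Iℝ`, as a function of the two real coordinates. -/
def restrictSlice (f : ℍ[ℝ] → ℍ[ℝ]) (I : ℍ[ℝ]) : ℝ × ℝ → ℍ[ℝ] :=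
  fun v => f ((v.1 : ℍ[ℝ]) + I * (v.2 : ℍ[ℝ]))

/-- The set of the real coordinates of the points of `Ω ∩ (ℝ + Iℝ)`. -/
def sliceCoords (Ω : Set ℍ[ℝ]) (I : ℍ[ℝ]) : Set (ℝ × ℝ) :=
  {v | (v.1 : ℍ[ℝ]) + I * (v.2 : ℍ[ℝ]) ∈ Ω}

/-- `f` is (slice) regular on the open set `Ω`: for every imaginary unit `I` the restriction to
`Ω ∩ (ℝ + Iℝ)` is of class `C¹` and `∂f/∂x + I ∂f/∂y = 0`. -/
def RegularOn (f : ℍ[ℝ] → ℍ[ℝ]) (Ω : Set ℍ[ℝ]) : Prop :=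
  ∀ I ∈ imagUnits,
    ContDiffOn ℝ 1 (restrictSlice f I) (sliceCoords Ω I) ∧
    ∀ v ∈ sliceCoords Ω I,
      fderiv ℝ (restrictSlice f I) v (1, 0) + I * fderiv ℝ (restrictSlice f I) v (0, 1) = 0

/-! ### The `*`-product, the regular conjugate and the regular reciprocal

A regular function on a symmetric slice domain has the form `f (x + Iy) = α + Iβ` on each sphere
`x + y𝕊`, where `α, β` do not depend on the imaginary unit `I`.  The `*`-product is obtained by
multiplying such expressions with `I` treated as central:
`(α + Iβ) * (γ + Iδ) = (αγ - βδ) + I(αδ + βγ)`, and the regular conjugate is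
`conj α + I conj β`.  The lemmas `starMul_eq_splitting` and `regConj_eq_splitting` check that on
each complex line these are the expressions in terms of the splitting `f = F + GJ`. -/

/-- The imaginary unit `I` for which `q = x + Iy` with `y > 0` (and `0` when `q` is real). -/
def imUnit (q : ℍ[ℝ]) : ℍ[ℝ] := (‖q.im‖)⁻¹ • q.im

/-- The coefficient `α` of `f = α + Iβ` on the sphere through `q`. -/
def stemRe (f : ℍ[ℝ] → ℍ[ℝ]) (q : ℍ[ℝ]) : ℍ[ℝ] := (1 / 2 : ℝ) • (f q + f (star q))

/-- The coefficient `β` of `f = α + Iβ` on the sphere through `q` (and `0` when `q` is real). -/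
def stemIm (f : ℍ[ℝ] → ℍ[ℝ]) (q : ℍ[ℝ]) : ℍ[ℝ] :=
  -(imUnit q * ((1 / 2 : ℝ) • (f q - f (star q))))

/-- The `*`-product `f * g`. -/
def starMul (f g : ℍ[ℝ] → ℍ[ℝ]) (q : ℍ[ℝ]) : ℍ[ℝ] :=
  (stemRe f q * stemRe g q - stemIm f q * stemIm g q)
    + imUnit q * (stemRe f q * stemIm g q + stemIm f q * stemRe g q)

/-- The regular conjugate `f^c`. -/
def regConj (f : ℍ[ℝ] → ℍ[ℝ]) (q : ℍ[ℝ]) : ℍ[ℝ] :=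
  star (stemRe f q) + imUnit q * star (stemIm f q)

/-- The symmetrization `f^s = f * f^c`. -/
def symmetrization (f : ℍ[ℝ] → ℍ[ℝ]) : ℍ[ℝ] → ℍ[ℝ] := starMul f (regConj f)

/-- The regular reciprocal `f^{-*} = (1 / f^s) f^c`, meaningful off the zero set of `f^s`. -/
def regInv (f : ℍ[ℝ] → ℍ[ℝ]) (q : ℍ[ℝ]) : ℍ[ℝ] := (symmetrization f q)⁻¹ * regConj f q

/-- The `n`th power with respect to the `*`-product. -/
def starPow (f : ℍ[ℝ] → ℍ[ℝ]) : ℕ → ℍ[ℝ] → ℍ[ℝ]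
  | 0 => fun _ => 1
  | n + 1 => starMul (starPow f n) f

/-- The function `(q - p)^{*k}` for an integer `k`; for `k = -m < 0` this is the regular reciprocal
of `(q - p)^{*m}`. -/
def linZPow (p : ℍ[ℝ]) : ℤ → ℍ[ℝ] → ℍ[ℝ]
  | Int.ofNat n => starPow (fun q => q - p) n
  | Int.negSucc n => regInv (starPow (fun q => q - p) (n + 1))

/-! ### Laurent expansions, poles, semiregular functions -/

/-- `p` and `q` lie on a common complex line. -/
def OnCommonSlice (q p : ℍ[ℝ]) : Prop := ∃ I ∈ imagUnits, q ∈ slice I ∧ p ∈ slice I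

open Classical in
def sigma (q p : ℍ[ℝ]) : ℝ :=
  if OnCommonSlice q p then ‖q - p‖
  else Real.sqrt ((q.re - p.re) ^ 2 + (‖q.im‖ + ‖p.im‖) ^ 2)

open Classical in
def tau (q p : ℍ[ℝ]) : ℝ :=
  if OnCommonSlice q p then ‖q - p‖
  else Real.sqrt ((q.re - p.re) ^ 2 + (‖q.im‖ - ‖p.im‖) ^ 2)

/-- The set `Σ(p, R₁, R₂)`. -/
def sigmaShell (p : ℍ[ℝ]) (R₁ R₂ : ℝ) : Set ℍ[ℝ] := {q | R₁ < tau q p ∧ sigma q p < R₂}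

/-- `p` is a singularity for functions that are regular on `Ω` (this includes the points of an open
symmetric `Ω`). -/
def IsSingularity (Ω : Set ℍ[ℝ]) (p : ℍ[ℝ]) : Prop := ∃ R > 0, sigmaShell p 0 R ⊆ Ω

/-- `f`, a function on `Ω`, has the Laurent expansion `∑ (q - p)^{*k} a_k`, `k ∈ ℤ`, at `p`: the
series converges to it on `Σ(p, 0, R) ⊆ Ω` for some `R > 0`.  (For small `R` the conjugate of a
non-real `p`, where `linZPow p k` is not meaningful for `k < 0`, is not in that set.) -/
def HasLaurentExpansion (f : ℍ[ℝ] → ℍ[ℝ]) (Ω : Set ℍ[ℝ]) (p : ℍ[ℝ]) (a : ℤ → ℍ[ℝ]) : Prop :=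
  ∃ R > 0, sigmaShell p 0 R ⊆ Ω ∧
    ∀ q ∈ sigmaShell p 0 R, HasSum (fun k : ℤ => linZPow p k q * a k) (f q)

/-- The Laurent expansion at `p` has no term of index less than `-m`. -/
def PoleOrderLE (f : ℍ[ℝ] → ℍ[ℝ]) (Ω : Set ℍ[ℝ]) (p : ℍ[ℝ]) (m : ℕ) : Prop :=
  ∃ a : ℤ → ℍ[ℝ], HasLaurentExpansion f Ω p a ∧ ∀ k : ℕ, m < k → a (-(k : ℤ)) = 0

/-- The order `ord_f(p)` (the least `m` as above), equal to `⊤` when `p` is not a pole. -/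
def poleOrder (f : ℍ[ℝ] → ℍ[ℝ]) (Ω : Set ℍ[ℝ]) (p : ℍ[ℝ]) : ℕ∞ :=
  sInf {t : ℕ∞ | ∃ m : ℕ, t = (m : ℕ∞) ∧ PoleOrderLE f Ω p m}

/-- Poles, poles of order `0` included. -/
def IsPole (f : ℍ[ℝ] → ℍ[ℝ]) (Ω : Set ℍ[ℝ]) (p : ℍ[ℝ]) : Prop := ∃ m : ℕ, PoleOrderLE f Ω p m

/-- Removable singularities: `f` extends to a neighborhood of `p` as a regular function. -/
def IsRemovable (f : ℍ[ℝ] → ℍ[ℝ]) (Ω : Set ℍ[ℝ]) (p : ℍ[ℝ]) : Prop :=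
  IsSingularity Ω p ∧ ∃ V : Set ℍ[ℝ], IsOpen V ∧ p ∈ V ∧
    ∃ h : ℍ[ℝ] → ℍ[ℝ], RegularOn h V ∧ EqOn h f (V ∩ Ω)

/-- `f`, with domain of definition `Ω'`, is semiregular in `Ω`. -/
structure SemiregularOn (f : ℍ[ℝ] → ℍ[ℝ]) (Ω' Ω : Set ℍ[ℝ]) : Prop where
  domain : IsSymmetricSliceDomain Ω
  domain' : IsSymmetricSliceDomain Ω'
  subset : Ω' ⊆ Ω
  regular : RegularOn f Ω'
  pole : ∀ p ∈ Ω \ Ω', IsPole f Ω' p ∨ IsRemovable f Ω' p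

/-- The function `[(q - p)^{*m} * (q - p̄)^{*n}]^{-*}`. -/
def poleFactor (p : ℍ[ℝ]) (m n : ℕ) : ℍ[ℝ] → ℍ[ℝ] :=
  regInv (starMul (starPow (fun q => q - p) m) (starPow (fun q => q - star p) n))

set_option linter.unusedSimpArgs false

/-! ### Comparison of the `*`-product with the splitting on a complex line -/

theorem star_imagUnit {I : ℍ[ℝ]} (hI : I ∈ imagUnits) : star I = -I := by
  have h : I ^ 2 = -1 := hI
  have h1 := congrArg QuaternionAlgebra.re h
  have h2 := congrArg QuaternionAlgebra.imI h
  have h3 := congrArg QuaternionAlgebra.imJ h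
  have h4 := congrArg QuaternionAlgebra.imK h
  simp [pow_two] at h1 h2 h3 h4
  have hre : I.re = 0 := by
    by_contra hne
    have e2 : I.imI = 0 := by
      have : I.re * I.imI = 0 := by linarith
      exact (mul_eq_zero.mp this).resolve_left hne
    have e3 : I.imJ = 0 := by
      have : I.re * I.imJ = 0 := by linarith
      exact (mul_eq_zero.mp this).resolve_left hne
    have e4 : I.imK = 0 := by
      have : I.re * I.imK = 0 := by linarith
      exact (mul_eq_zero.mp this).resolve_left hne
    rw [e2, e3, e4] at h1
    nlinarith [mul_self_nonneg I.re]
  ext <;> simp [hre]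

theorem norm_imagUnit {I : ℍ[ℝ]} (hI : I ∈ imagUnits) : ‖I‖ = 1 := by
  have h : I ^ 2 = -1 := hI
  have h1 : ‖I‖ ^ 2 = 1 := by rw [← norm_pow, h, norm_neg, norm_one]
  nlinarith [norm_nonneg I]

theorem imUnit_slice {I : ℍ[ℝ]} (hI : I ∈ imagUnits) (x y : ℝ) :
    imUnit ((x : ℍ[ℝ]) + I * (y : ℍ[ℝ])) = (|y|⁻¹ * y) • I := by
  have hre : I.re = 0 := by
    have := congrArg QuaternionAlgebra.re (star_imagUnit hI)
    simp at this
    linarith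
  have him : ((x : ℍ[ℝ]) + I * (y : ℍ[ℝ])).im = y • I := by
    ext <;> simp [hre, mul_comm]
  rw [imUnit, him, norm_smul, norm_imagUnit hI, smul_smul]
  simp

theorem star_slice {I : ℍ[ℝ]} (hI : I ∈ imagUnits) (x y : ℝ) :
    star ((x : ℍ[ℝ]) + I * (y : ℍ[ℝ])) = (x : ℍ[ℝ]) - I * (y : ℍ[ℝ]) := by
  rw [star_add, star_mul, star_imagUnit hI, Quaternion.star_coe, Quaternion.star_coe,
    Quaternion.coe_commutes y (-I)]
  simp [sub_eq_add_neg]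

theorem slice_eq_smul (I : ℍ[ℝ]) (x y : ℝ) :
    (x : ℍ[ℝ]) + I * (y : ℍ[ℝ]) = x • (1 : ℍ[ℝ]) + y • I := by
  rw [Quaternion.mul_coe_eq_smul]
  congr 1
  ext <;> simp

/-- On the complex line `ℝ + Iℝ`, if `f = F + GJ` and `g = H + KJ` with `J ⊥ I`, the `*`-product is
`[F(z)H(z) - G(z) conj K(z̄)] + [F(z)K(z) + G(z) conj H(z̄)]J`. -/
theorem starMul_eq_splitting {I J : ℍ[ℝ]} (hI : I ∈ imagUnits) (hJ : J ∈ imagUnits)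
    (hIJ : J * I = -(I * J)) {f g F G H K : ℍ[ℝ] → ℍ[ℝ]}
    (hF : ∀ z ∈ slice I, F z ∈ slice I) (hG : ∀ z ∈ slice I, G z ∈ slice I)
    (hH : ∀ z ∈ slice I, H z ∈ slice I) (hK : ∀ z ∈ slice I, K z ∈ slice I)
    (hf : ∀ z ∈ slice I, f z = F z + G z * J) (hg : ∀ z ∈ slice I, g z = H z + K z * J)
    {z : ℍ[ℝ]} (hz : z ∈ slice I) :
    starMul f g z = (F z * H z - G z * star (K (star z)))
      + (F z * K z + G z * star (H (star z))) * J := by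
  obtain ⟨x, y, rfl⟩ := hz
  have hz : (x : ℍ[ℝ]) + I * (y : ℍ[ℝ]) ∈ slice I := ⟨x, y, rfl⟩
  have hz' : star ((x : ℍ[ℝ]) + I * (y : ℍ[ℝ])) ∈ slice I :=
    ⟨x, -y, by rw [star_slice hI]; simp [sub_eq_add_neg]⟩
  have hII : I * I = -1 := by rw [← pow_two]; exact hI
  have hJJ : J * J = -1 := by rw [← pow_two]; exact hJ
  have hIIJ : I * (I * J) = -J := by rw [← mul_assoc, hII, neg_one_mul]
  have hJIJ : J * (I * J) = I := by rw [← mul_assoc, hIJ, neg_mul, mul_assoc, hJJ]; simp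
  have hIJI : I * J * I = J := by rw [mul_assoc, hIJ, mul_neg, hIIJ, neg_neg]
  have hIJJ : I * J * J = -I := by rw [mul_assoc, hJJ]; simp
  have hIJIJ : I * J * (I * J) = -1 := by rw [← mul_assoc, hIJI, hJJ]
  have hsI := star_imagUnit hI
  have hL := imUnit_slice hI x y
  simp only [starMul, stemRe, stemIm, hL, hf _ hz, hf _ hz', hg _ hz, hg _ hz']
  by_cases hy : y = 0
  · have hs : star ((x : ℍ[ℝ]) + I * (y : ℍ[ℝ])) = (x : ℍ[ℝ]) + I * (y : ℍ[ℝ]) := by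
      rw [star_slice hI]; simp [hy]
    rw [hs]
    obtain ⟨a1, a2, ha⟩ := hF _ hz
    obtain ⟨b1, b2, hb⟩ := hG _ hz
    obtain ⟨c1, c2, hc⟩ := hH _ hz
    obtain ⟨d1, d2, hd⟩ := hK _ hz
    rw [ha, hb, hc, hd]
    simp only [hy, slice_eq_smul, star_add, Quaternion.star_smul, star_one, hsI, add_mul,
      mul_add, smul_mul_assoc, mul_smul_comm, sub_self, smul_zero, mul_zero, neg_zero,
      zero_mul, zero_smul, sub_zero, add_zero, smul_add, one_mul, mul_one, hII, hJJ, hIIJ, hJIJ,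
      hIJI, hIJJ, hIJIJ, hIJ, mul_neg, neg_mul, smul_neg, smul_smul]
    module
  · obtain ⟨t, ht, ht2⟩ : ∃ t : ℝ, |y|⁻¹ * y = t ∧ (t = 1 ∨ t = -1) := by
      refine ⟨_, rfl, ?_⟩
      rcases lt_or_gt_of_ne hy with h | h
      · right; rw [abs_of_neg h]; field_simp
      · left; rw [abs_of_pos h]; field_simp
    obtain ⟨a1, a2, ha⟩ := hF _ hz
    obtain ⟨b1, b2, hb⟩ := hG _ hz
    obtain ⟨c1, c2, hc⟩ := hH _ hz
    obtain ⟨d1, d2, hd⟩ := hK _ hz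
    obtain ⟨a1', a2', ha'⟩ := hF _ hz'
    obtain ⟨b1', b2', hb'⟩ := hG _ hz'
    obtain ⟨c1', c2', hc'⟩ := hH _ hz'
    obtain ⟨d1', d2', hd'⟩ := hK _ hz'
    rw [ht, ha, hb, hc, hd, ha', hb', hc', hd']
    rcases ht2 with rfl | rfl <;>
    simp only [slice_eq_smul, star_add, Quaternion.star_smul, star_one, hsI, add_mul,
      mul_add, sub_mul, mul_sub, smul_mul_assoc, mul_smul_comm, smul_sub, smul_add, one_smul,
      one_mul, mul_one, hII, hJJ, hIIJ, hJIJ,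
      hIJI, hIJJ, hIJIJ, hIJ, mul_neg, neg_mul, smul_neg, smul_smul, neg_smul, neg_neg] <;>
    module

/-- On the complex line `ℝ + Iℝ`, if `f = F + GJ` with `J ⊥ I`, the regular conjugate is
`conj F(z̄) - G(z)J`. -/
theorem regConj_eq_splitting {I J : ℍ[ℝ]} (hI : I ∈ imagUnits) (hJ : J ∈ imagUnits)
    (hIJ : J * I = -(I * J)) {f F G : ℍ[ℝ] → ℍ[ℝ]}
    (hF : ∀ z ∈ slice I, F z ∈ slice I) (hG : ∀ z ∈ slice I, G z ∈ slice I)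
    (hf : ∀ z ∈ slice I, f z = F z + G z * J) {z : ℍ[ℝ]} (hz : z ∈ slice I) :
    regConj f z = star (F (star z)) - G z * J := by
  obtain ⟨x, y, rfl⟩ := hz
  have hz : (x : ℍ[ℝ]) + I * (y : ℍ[ℝ]) ∈ slice I := ⟨x, y, rfl⟩
  have hz' : star ((x : ℍ[ℝ]) + I * (y : ℍ[ℝ])) ∈ slice I :=
    ⟨x, -y, by rw [star_slice hI]; simp [sub_eq_add_neg]⟩
  have hII : I * I = -1 := by rw [← pow_two]; exact hI
  have hIIJ : I * (I * J) = -J := by rw [← mul_assoc, hII, neg_one_mul]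
  have hIJI : I * J * I = J := by rw [mul_assoc, hIJ, mul_neg, hIIJ, neg_neg]
  have hsI := star_imagUnit hI
  have hsJ := star_imagUnit hJ
  have hL := imUnit_slice hI x y
  simp only [regConj, stemRe, stemIm, hL, hf _ hz, hf _ hz']
  by_cases hy : y = 0
  · have hs : star ((x : ℍ[ℝ]) + I * (y : ℍ[ℝ])) = (x : ℍ[ℝ]) + I * (y : ℍ[ℝ]) := by
      rw [star_slice hI]; simp [hy]
    rw [hs]
    obtain ⟨a1, a2, ha⟩ := hF _ hz
    obtain ⟨b1, b2, hb⟩ := hG _ hz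
    rw [ha, hb]
    simp only [hy, slice_eq_smul, star_add, Quaternion.star_smul, star_one, star_mul, star_neg, star_zero,
      hsI, hsJ, add_mul, mul_add, smul_mul_assoc, mul_smul_comm, sub_self, smul_zero,
      mul_zero, neg_zero, zero_mul, zero_smul, add_zero, smul_add, one_mul, mul_one, hII,
      hIIJ, hIJI, hIJ, mul_neg, neg_mul, smul_neg, smul_smul, neg_neg]
    module
  · obtain ⟨t, ht, ht2⟩ : ∃ t : ℝ, |y|⁻¹ * y = t ∧ (t = 1 ∨ t = -1) := by
      refine ⟨_, rfl, ?_⟩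
      rcases lt_or_gt_of_ne hy with h | h
      · right; rw [abs_of_neg h]; field_simp
      · left; rw [abs_of_pos h]; field_simp
    obtain ⟨a1, a2, ha⟩ := hF _ hz
    obtain ⟨b1, b2, hb⟩ := hG _ hz
    obtain ⟨a1', a2', ha'⟩ := hF _ hz'
    obtain ⟨b1', b2', hb'⟩ := hG _ hz'
    rw [ht, ha, hb, ha', hb']
    rcases ht2 with rfl | rfl <;>
    simp only [slice_eq_smul, star_add, star_sub, Quaternion.star_smul, star_one, star_mul, star_neg, hsI, hsJ,
      add_mul, mul_add, sub_mul, mul_sub, smul_mul_assoc, mul_smul_comm, smul_sub,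
      smul_add, one_smul, one_mul, mul_one, hII, hIIJ,
      hIJI, hIJ, mul_neg, neg_mul, smul_neg, smul_smul, neg_smul, neg_neg] <;>
    module

end

end SliceRegular

namespace SliceRegular

noncomputable section

/-! ### Complex coordinates on the slices -/

/-! Everything reduces to complex analysis on the single line `ℝ + Iℝ` through `p` and its
conjugate. Left multiplication by that line makes `ℍ` a complex vector space `V I`, and the
regularity equation becomes the Cauchy–Riemann equation. So `f` restricts to a holomorphic `V
I`-valued function (`regularOn_iff`). Two facts link the line to the whole domain. First, by the
identity principle a regular function on a symmetric slice domain is of the form `α + Jβ` on each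
sphere (`RegularOn.affineAt`). It is therefore determined by its values on one line, and conversely
every holomorphic function on a line, with symmetric domain, extends (`regularOn_sliceExt`). Second,
if `h` maps the line into itself, then `h * g` is the pointwise product on that line
(`starMul_of_preserves_at`). The powers `(q - p)^{*k}` are such functions, with restriction `(z -
z₀)^k` off the conjugate of `z₀`. Hence Laurent expansions in `*`-powers become ordinary ones, and
the orders of `f` at `p` and at its conjugate are the pole orders at `z₀` and `z̄₀` of one
holomorphic function (`poleOrderLE_iff`). The factor `g` is then forced on the line: it is `(z -
z₀)^m (z - z̄₀)^n f(z)`, whose singularities at `z₀` and `z̄₀` are removable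
(`exists_isSliceFactor`). Its slice extension satisfies both equalities, because slice functions
that agree on one line agree everywhere. Uniqueness follows by inverting the factor on the line,
filling the two points by continuity and extending to the other lines
(`IsSliceFactor.eqOn_of_eq_starMul`). When `z₀ ≠ z̄₀`, a zero of `g` at one of the two points allows
one more linear factor to be removed there. This contradicts the minimality of a positive order
(`PoleLE.of_eq_zero`), so a zero at `p` is possible only for `m = 0`, and then `f` tends to `0` on
the line. -/

theorem imagUnit_mul_self (I : imagUnits) : (I : ℍ[ℝ]) * I = -1 := by
  rw [← pow_two]; exact I.2

/-- The embedding of `ℂ` onto the complex line `ℝ + Iℝ`. -/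
def cx (I : imagUnits) : ℂ →ₐ[ℝ] ℍ[ℝ] := Complex.liftAux (I : ℍ[ℝ]) (imagUnit_mul_self I)

theorem cx_apply (I : imagUnits) (z : ℂ) : cx I z = (z.re : ℍ[ℝ]) + I * (z.im : ℍ[ℝ]) := by
  rw [cx, Complex.liftAux_apply, Quaternion.mul_coe_eq_smul]
  rfl

theorem cx_I (I : imagUnits) : cx I Complex.I = I := by simp [cx]

theorem cx_ofReal (I : imagUnits) (r : ℝ) : cx I (r : ℂ) = (r : ℍ[ℝ]) := by simp

theorem coe_mul_comm_cx (I : imagUnits) (z : ℂ) : (I : ℍ[ℝ]) * cx I z = cx I z * I := by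
  rw [← cx_I I, ← map_mul, ← map_mul, mul_comm]

theorem star_cx (I : imagUnits) (z : ℂ) : star (cx I z) = cx I (star z) := by
  rw [cx_apply, star_slice I.2, cx_apply]
  simp [sub_eq_add_neg]

theorem norm_cx (I : imagUnits) (z : ℂ) : ‖cx I z‖ = ‖z‖ := by
  have h : ((Quaternion.normSq (cx I z) : ℝ) : ℍ[ℝ]) = ((Complex.normSq z : ℝ) : ℍ[ℝ]) := by
    rw [← Quaternion.self_mul_star (cx I z), star_cx, ← map_mul, ← cx_ofReal I]
    congr 1
    exact Complex.mul_conj z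
  have h2 : Quaternion.normSq (cx I z) = Complex.normSq z := Quaternion.coe_injective h
  rw [Quaternion.normSq_eq_norm_mul_self, Complex.normSq_eq_norm_sq, pow_two] at h2
  exact (mul_self_inj (norm_nonneg _) (norm_nonneg _)).mp h2

theorem isometry_cx (I : imagUnits) : Isometry (cx I) :=
  AddMonoidHomClass.isometry_of_norm (cx I) (norm_cx I)

theorem cx_injective (I : imagUnits) : Function.Injective (cx I) := (isometry_cx I).injective

theorem continuous_cx (I : imagUnits) : Continuous (cx I) := (isometry_cx I).continuous

/-- The opposite imaginary unit. -/
def negUnit (I : imagUnits) : imagUnits := ⟨-I, by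
  have : (I : ℍ[ℝ]) ^ 2 = -1 := I.2
  change (-(I : ℍ[ℝ])) ^ 2 = -1
  rw [neg_sq, this]⟩

theorem coe_negUnit (I : imagUnits) : (negUnit I : ℍ[ℝ]) = -I := rfl

theorem cx_negUnit (I : imagUnits) (z : ℂ) : cx (negUnit I) z = cx I (star z) := by
  simp [cx_apply, coe_negUnit]

theorem cx_star (I : imagUnits) (z : ℂ) : cx I (star z) = cx (negUnit I) z :=
  (cx_negUnit I z).symm

theorem cx_eq_of_im_eq_zero (I J : imagUnits) {z : ℂ} (hz : z.im = 0) : cx I z = cx J z := by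
  simp [cx_apply, hz]

theorem range_cx (I : imagUnits) : range (cx I) = slice I := by
  ext q
  constructor
  · rintro ⟨z, rfl⟩
    exact ⟨z.re, z.im, cx_apply I z⟩
  · rintro ⟨x, y, rfl⟩
    exact ⟨⟨x, y⟩, cx_apply I _⟩

theorem re_imagUnit (I : imagUnits) : (I : ℍ[ℝ]).re = 0 := by
  have := congrArg QuaternionAlgebra.re (star_imagUnit I.2)
  simp at this
  linarith

theorem re_cx (I : imagUnits) (z : ℂ) : (cx I z).re = z.re := by
  simp [cx_apply, re_imagUnit]

theorem im_cx (I : imagUnits) (z : ℂ) : (cx I z).im = z.im • (I : ℍ[ℝ]) := by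
  rw [cx_apply]
  ext <;> simp [re_imagUnit, mul_comm]

theorem norm_im_cx (I : imagUnits) (z : ℂ) : ‖(cx I z).im‖ = |z.im| := by
  rw [im_cx, norm_smul, norm_imagUnit I.2, mul_one, Real.norm_eq_abs]

theorem imUnit_cx (I : imagUnits) (z : ℂ) : imUnit (cx I z) = (|z.im|⁻¹ * z.im) • (I : ℍ[ℝ]) := by
  rw [cx_apply, imUnit_slice I.2]

theorem mem_imagUnits_of_re_eq_zero {q : ℍ[ℝ]} (h : q.re = 0) (h1 : ‖q‖ = 1) : q ∈ imagUnits := by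
  have hs : star q = -q := by ext <;> simp [h]
  have := Quaternion.self_mul_star q
  rw [hs, Quaternion.normSq_eq_norm_mul_self, h1] at this
  change q ^ 2 = -1
  rw [pow_two]
  have h2 : -(q * q) = 1 := by simpa using this
  rw [← h2, neg_neg]

/-- The point of the closed upper half plane that corresponds to `q`. -/
def upperCoord (q : ℍ[ℝ]) : ℂ := ⟨q.re, ‖q.im‖⟩

theorem continuous_upperCoord : Continuous upperCoord := by
  have : upperCoord = fun q : ℍ[ℝ] => (q.re : ℂ) + (‖q.im‖ : ℂ) * Complex.I := by
    ext q; apply Complex.ext <;> simp [upperCoord]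
  rw [this]
  have h1 := Quaternion.continuous_re
  have h2 := Quaternion.continuous_im
  fun_prop

theorem exists_cx_upperCoord (I : imagUnits) (q : ℍ[ℝ]) :
    ∃ J : imagUnits, cx J (upperCoord q) = q ∧ (q.im = 0 → J = I) := by
  by_cases h : q.im = 0
  · refine ⟨I, ?_, fun _ => rfl⟩
    rw [cx_apply]
    simp only [upperCoord, h, norm_zero]
    conv_rhs => rw [← Quaternion.re_add_im q, h]
    simp
  · have hn : ‖q.im‖ ≠ 0 := norm_ne_zero_iff.mpr h
    refine ⟨⟨(‖q.im‖)⁻¹ • q.im, mem_imagUnits_of_re_eq_zero (by simp) ?_⟩, ?_,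
      fun h' => (h h').elim⟩
    · rw [norm_smul, norm_inv, norm_norm, inv_mul_cancel₀ hn]
    · rw [cx_apply, Quaternion.mul_coe_eq_smul, smul_smul]
      simp only [upperCoord]
      rw [mul_inv_cancel₀ hn, one_smul, Quaternion.re_add_im]

theorem exists_cx_eq (I : imagUnits) (q : ℍ[ℝ]) : ∃ (J : imagUnits) (z : ℂ), cx J z = q :=
  let ⟨J, hJ, _⟩ := exists_cx_upperCoord I q
  ⟨J, _, hJ⟩

theorem upperCoord_cx (I : imagUnits) (z : ℂ) : upperCoord (cx I z) = z ∨
    upperCoord (cx I z) = star z := by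
  rcases le_total 0 z.im with h | h
  · left; apply Complex.ext <;> simp [upperCoord, re_cx, norm_im_cx, abs_of_nonneg h]
  · right; apply Complex.ext <;> simp [upperCoord, re_cx, norm_im_cx, abs_of_nonpos h]

/-! ### Axially symmetric sets and spheres in complex coordinates. -/

theorem IsAxiallySymmetric.cx_mem {T : Set ℍ[ℝ]} (hT : IsAxiallySymmetric T) {I : imagUnits}
    {z : ℂ} (h : cx I z ∈ T) (J : imagUnits) : cx J z ∈ T := by
  rw [cx_apply] at h ⊢
  exact hT _ _ I I.2 h ⟨J, J.2, rfl⟩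

theorem IsAxiallySymmetric.cx_star_mem {T : Set ℍ[ℝ]} (hT : IsAxiallySymmetric T) {I : imagUnits}
    {z : ℂ} (h : cx I z ∈ T) (J : imagUnits) : cx J (star z) ∈ T := by
  rw [cx_star]; exact hT.cx_mem h _

theorem mem_sphere_iff {x y : ℝ} {I : imagUnits} {z : ℂ} :
    cx I z ∈ sphere x y ↔ z = ⟨x, y⟩ ∨ z = star (⟨x, y⟩ : ℂ) := by
  constructor
  · rintro ⟨J, hJ, h⟩
    have h' : cx I z = cx ⟨J, hJ⟩ ⟨x, y⟩ := by rw [h, cx_apply]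
    have h1 := congrArg (fun q : ℍ[ℝ] => q.re) h'
    have h2 := congrArg (fun q : ℍ[ℝ] => ‖q.im‖) h'
    simp only [re_cx, norm_im_cx] at h1 h2
    rcases abs_eq_abs.mp h2 with h3 | h3
    · left; exact Complex.ext h1 h3
    · right; apply Complex.ext <;> simp [h1, h3]
  · rintro (rfl | rfl)
    · exact ⟨I, I.2, cx_apply I _⟩
    · refine ⟨negUnit I, (negUnit I).2, ?_⟩
      rw [cx_star, cx_apply]

theorem isAxiallySymmetric_sphere (x y : ℝ) : IsAxiallySymmetric (sphere x y) := by
  rintro a b J hJ h _ ⟨K, hK, rfl⟩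
  have h1 : cx ⟨J, hJ⟩ ⟨a, b⟩ ∈ sphere x y := by rw [cx_apply]; exact h
  have h2 : cx ⟨K, hK⟩ ⟨a, b⟩ ∈ sphere x y := mem_sphere_iff.mpr (mem_sphere_iff.mp h1)
  rw [cx_apply] at h2
  exact h2

theorem IsAxiallySymmetric.union {S T : Set ℍ[ℝ]} (hS : IsAxiallySymmetric S)
    (hT : IsAxiallySymmetric T) : IsAxiallySymmetric (S ∪ T) := fun x y I hI h =>
  h.elim (fun h => (hS x y I hI h).trans subset_union_left)
    (fun h => (hT x y I hI h).trans subset_union_right)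

theorem IsAxiallySymmetric.mem_iff {T : Set ℍ[ℝ]} (hT : IsAxiallySymmetric T) (I : imagUnits)
    (q : ℍ[ℝ]) : q ∈ T ↔ cx I (upperCoord q) ∈ T := by
  obtain ⟨J, hJ, -⟩ := exists_cx_upperCoord I q
  constructor
  · intro h; rw [← hJ] at h; exact hT.cx_mem h I
  · intro h; rw [← hJ]; exact hT.cx_mem h J

/-! ### Slices as complex vector spaces -/

/-- The quaternions with the complex structure given by left multiplication by `I`. -/
def V (_ : imagUnits) : Type := ℍ[ℝ]

instance (I : imagUnits) : NormedAddCommGroup (V I) := inferInstanceAs (NormedAddCommGroup ℍ[ℝ])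

instance (I : imagUnits) : CompleteSpace (V I) := inferInstanceAs (CompleteSpace ℍ[ℝ])

/-- The identity map from `ℍ` to `V I`. -/
def toV (I : imagUnits) : ℍ[ℝ] ≃+ V I := AddEquiv.refl ℍ[ℝ]

theorem norm_toV (I : imagUnits) (h : ℍ[ℝ]) : ‖toV I h‖ = ‖h‖ := rfl

/-- Laurent coefficients stand on the right, so left multiplication by the line is the scalar action
under which `∑ (z - z₀)^k a_k` is an ordinary vector-valued series. -/
instance (I : imagUnits) : Module ℂ (V I) where
  smul z h := toV I (cx I z * (toV I).symm h)
  one_smul h := by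
    change toV I (cx I 1 * (toV I).symm h) = h
    rw [map_one, one_mul, AddEquiv.apply_symm_apply]
  mul_smul z w h := by
    change toV I (cx I (z * w) * (toV I).symm h) =
      toV I (cx I z * (toV I).symm (toV I (cx I w * (toV I).symm h)))
    rw [map_mul (cx I), mul_assoc, AddEquiv.symm_apply_apply]
  smul_zero z := by
    change toV I (cx I z * (toV I).symm 0) = 0
    rw [map_zero, mul_zero, map_zero]
  smul_add z h k := by
    change toV I (cx I z * (toV I).symm (h + k)) =
      toV I (cx I z * (toV I).symm h) + toV I (cx I z * (toV I).symm k)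
    rw [map_add, mul_add, map_add]
  add_smul z w h := by
    change toV I (cx I (z + w) * (toV I).symm h) =
      toV I (cx I z * (toV I).symm h) + toV I (cx I w * (toV I).symm h)
    rw [map_add, add_mul, map_add]
  zero_smul h := by
    change toV I (cx I 0 * (toV I).symm h) = 0
    rw [map_zero, zero_mul, map_zero]

theorem smul_toV (I : imagUnits) (z : ℂ) (h : ℍ[ℝ]) : z • toV I h = toV I (cx I z * h) := rfl

instance (I : imagUnits) : NormedSpace ℂ (V I) where
  norm_smul_le z h := by
    obtain ⟨k, rfl⟩ := (toV I).surjective h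
    rw [smul_toV, norm_toV, norm_toV, norm_mul, norm_cx]

theorem isometry_toV (I : imagUnits) : Isometry (toV I) :=
  AddMonoidHomClass.isometry_of_norm (toV I) (norm_toV I)

theorem isometry_toV_symm (I : imagUnits) : Isometry (toV I).symm :=
  AddMonoidHomClass.isometry_of_norm (toV I).symm fun _ => rfl

/-- The function `f` on the line `ℝ + Iℝ`, in the complex coordinate. -/
def sliceFn (f : ℍ[ℝ] → ℍ[ℝ]) (I : imagUnits) : ℂ → V I := fun z => toV I (f (cx I z))

/-- The real-linear map `w ↦ w d` from `ℝ + Iℝ` to `ℍ`. -/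
def mulRightCLM (I : imagUnits) (d : ℍ[ℝ]) : ℂ →L[ℝ] ℍ[ℝ] :=
  LinearMap.toContinuousLinearMap ((LinearMap.mulRight ℝ d).comp (cx I).toLinearMap)

theorem mulRightCLM_apply (I : imagUnits) (d : ℍ[ℝ]) (w : ℂ) :
    mulRightCLM I d w = cx I w * d := rfl

/-- Since `toV I` preserves norms, both sides are the same little-o estimate. -/
theorem hasDerivAt_toV_iff {I : imagUnits} {γ : ℂ → ℍ[ℝ]} {d : ℍ[ℝ]} {z : ℂ} :
    HasDerivAt (fun w => toV I (γ w)) (toV I d) z ↔ HasFDerivAt (𝕜 := ℝ) γ (mulRightCLM I d) z := by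
  rw [hasDerivAt_iff_isLittleO, hasFDerivAt_iff_isLittleO, Asymptotics.isLittleO_iff,
    Asymptotics.isLittleO_iff]
  simp only [smul_toV, ← map_sub, norm_toV, mulRightCLM_apply]

theorem differentiableAt_toV_iff {I : imagUnits} {γ : ℂ → ℍ[ℝ]} {z : ℂ} :
    DifferentiableAt ℂ (fun w => toV I (γ w)) z ↔
      ∃ d, HasFDerivAt (𝕜 := ℝ) γ (mulRightCLM I d) z := by
  constructor
  · intro h
    exact ⟨(toV I).symm (deriv (fun w => toV I (γ w)) z), hasDerivAt_toV_iff.mp (by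
      rw [AddEquiv.apply_symm_apply]; exact h.hasDerivAt)⟩
  · rintro ⟨d, hd⟩
    exact (hasDerivAt_toV_iff.mpr hd).differentiableAt

/-! ### Slice functions and the representation formula -/

/-- On the sphere through the points with coordinate `z`, `f` has the form `α + Iβ`. -/
def AffineAt (f : ℍ[ℝ] → ℍ[ℝ]) (z : ℂ) : Prop :=
  ∃ a b : ℍ[ℝ], ∀ J : imagUnits, f (cx J z) = a + J * b

/-- The value at `x + Jy` of a slice function with the values `A` and `B` at `x + Iy` and
`x - Iy`. -/
def rep (I J : imagUnits) (A B : ℍ[ℝ]) : ℍ[ℝ] :=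
  (1 / 2 : ℝ) • ((1 - J * I) * A + (1 + J * I) * B)

theorem rep_self_left (I : imagUnits) (A B : ℍ[ℝ]) : rep I I A B = A := by
  rw [rep, imagUnit_mul_self, sub_neg_eq_add, add_neg_cancel, zero_mul, add_zero, add_mul, one_mul]
  module

theorem rep_diag (I J : imagUnits) (A : ℍ[ℝ]) : rep I J A A = A := by
  rw [rep, sub_mul, add_mul, one_mul]
  module

theorem rep_negUnit (I J : imagUnits) (A B : ℍ[ℝ]) : rep I (negUnit J) A B = rep I J B A := by
  rw [rep, rep, coe_negUnit, neg_mul, sub_neg_eq_add, ← sub_eq_add_neg, add_comm]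

theorem rep_eq_add_mul (I J : imagUnits) (A B : ℍ[ℝ]) :
    rep I J A B = (1 / 2 : ℝ) • (A + B) + J * ((1 / 2 : ℝ) • (I * (B - A))) := by
  rw [rep, sub_mul, add_mul, one_mul, one_mul, mul_smul_comm, mul_sub, mul_sub, mul_assoc,
    mul_assoc]
  module

theorem AffineAt.rep_eq {f : ℍ[ℝ] → ℍ[ℝ]} {z : ℂ} (h : AffineAt f z) (I J : imagUnits) :
    f (cx J z) = rep I J (f (cx I z)) (f (cx I (star z))) := by
  obtain ⟨a, b, hab⟩ := h
  have e : (I : ℍ[ℝ]) * (I * b) = -b := by rw [← mul_assoc, imagUnit_mul_self, neg_one_mul]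
  rw [cx_star, hab, hab, hab, rep_eq_add_mul, coe_negUnit, neg_mul]
  have e2 : (I : ℍ[ℝ]) * (a + -(I * b) - (a + I * b)) = (2 : ℝ) • b := by
    rw [mul_sub, mul_add, mul_add, mul_neg, e]
    module
  rw [e2, smul_smul]
  norm_num
  module

/-- Two points of a sphere on one line determine `α` and `β`. Identities checked on `ℝ + Iℝ` pass to
all of `ℍ` in this way. -/
theorem AffineAt.eq_of_eq {f g : ℍ[ℝ] → ℍ[ℝ]} {z : ℂ} (hf : AffineAt f z) (hg : AffineAt g z)
    (I : imagUnits) (h : f (cx I z) = g (cx I z)) (h' : f (cx I (star z)) = g (cx I (star z)))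
    (J : imagUnits) : f (cx J z) = g (cx J z) := by
  rw [hf.rep_eq I, hg.rep_eq I, h, h']

theorem affineAt_of_rep {f : ℍ[ℝ] → ℍ[ℝ]} {z : ℂ} (I : imagUnits) {A B : ℍ[ℝ]}
    (h : ∀ J, f (cx J z) = rep I J A B) : AffineAt f z :=
  ⟨_, _, fun J => (h J).trans (rep_eq_add_mul I J A B)⟩

theorem affineAt_of_im_eq_zero (f : ℍ[ℝ] → ℍ[ℝ]) {z : ℂ} (hz : z.im = 0) : AffineAt f z :=
  ⟨f (z.re : ℍ[ℝ]), 0, fun J => by simp [cx_apply, hz]⟩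

theorem affineAt_const (c : ℍ[ℝ]) (z : ℂ) : AffineAt (fun _ => c) z :=
  ⟨c, 0, fun J => by simp⟩

theorem affineAt_sub_const (p : ℍ[ℝ]) (z : ℂ) : AffineAt (fun q => q - p) z :=
  ⟨(z.re : ℍ[ℝ]) - p, (z.im : ℍ[ℝ]), fun J => by
    change cx J z - p = _
    rw [cx_apply]; abel⟩

theorem abs_inv_mul_self_mul_self {y : ℝ} (hy : y ≠ 0) : |y|⁻¹ * y * (|y|⁻¹ * y) = 1 := by
  have : |y| ≠ 0 := abs_ne_zero.mpr hy
  have h2 := abs_mul_abs_self y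
  field_simp
  nlinarith

/-! ### Stem coefficients of products, conjugates and reciprocals. -/

section stems

variable {f : ℍ[ℝ] → ℍ[ℝ]} {z : ℂ} {a b : ℍ[ℝ]}

theorem stemRe_cx (h : ∀ J : imagUnits, f (cx J z) = a + J * b) (J : imagUnits) :
    stemRe f (cx J z) = a := by
  rw [stemRe, star_cx, cx_star, h, h, coe_negUnit, neg_mul]
  module

/-- The factor is the sign of `z.im`: `imUnit` always selects the unit with positive imaginary
coordinate. The sign occurs twice in each product and cancels; at real points it is `0`. -/
theorem stemIm_cx (h : ∀ J : imagUnits, f (cx J z) = a + J * b) (J : imagUnits) :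
    stemIm f (cx J z) = (|z.im|⁻¹ * z.im) • b := by
  have e : (J : ℍ[ℝ]) * (J * b) = -b := by rw [← mul_assoc, imagUnit_mul_self, neg_one_mul]
  rw [stemIm, star_cx, cx_star, h, h, coe_negUnit, imUnit_cx, neg_mul]
  have : (1 / 2 : ℝ) • (a + J * b - (a + -(J * b))) = J * b := by module
  rw [this, smul_mul_assoc, e]
  module

end stems

theorem starMul_cx {f g : ℍ[ℝ] → ℍ[ℝ]} {z : ℂ} (hz : z.im ≠ 0) {a b c d : ℍ[ℝ]}
    (hf : ∀ J : imagUnits, f (cx J z) = a + J * b) (hg : ∀ J : imagUnits, g (cx J z) = c + J * d)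
    (J : imagUnits) : starMul f g (cx J z) = (a * c - b * d) + J * (a * d + b * c) := by
  have ht := abs_inv_mul_self_mul_self hz
  rw [starMul, stemRe_cx hf, stemRe_cx hg, stemIm_cx hf, stemIm_cx hg, imUnit_cx]
  set t := |z.im|⁻¹ * z.im
  rw [smul_mul_smul_comm, ht, one_smul, mul_smul_comm, smul_mul_assoc t b, ← smul_add,
    smul_mul_smul_comm, ht, one_smul]

theorem regConj_cx {f : ℍ[ℝ] → ℍ[ℝ]} {z : ℂ} (hz : z.im ≠ 0) {a b : ℍ[ℝ]}
    (hf : ∀ J : imagUnits, f (cx J z) = a + J * b) (J : imagUnits) :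
    regConj f (cx J z) = star a + J * star b := by
  have ht := abs_inv_mul_self_mul_self hz
  rw [regConj, stemRe_cx hf, stemIm_cx hf, imUnit_cx, Quaternion.star_smul, smul_mul_smul_comm, ht,
    one_smul]

theorem AffineAt.starMul {f g : ℍ[ℝ] → ℍ[ℝ]} {z : ℂ} (hf : AffineAt f z) (hg : AffineAt g z) :
    AffineAt (SliceRegular.starMul f g) z := by
  by_cases hz : z.im = 0
  · exact affineAt_of_im_eq_zero _ hz
  · obtain ⟨a, b, h⟩ := hf
    obtain ⟨c, d, h'⟩ := hg
    exact ⟨_, _, starMul_cx hz h h'⟩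

theorem affineAt_starPow_sub (p : ℍ[ℝ]) (z : ℂ) (n : ℕ) :
    AffineAt (starPow (fun q => q - p) n) z := by
  induction n with
  | zero => exact affineAt_const 1 z
  | succ n ih => exact ih.starMul (affineAt_sub_const p z)

theorem affineAt_cx_mul {r f : ℍ[ℝ] → ℍ[ℝ]} {z w : ℂ} (hr : ∀ J : imagUnits, r (cx J z) = cx J w)
    (hf : AffineAt f z) : AffineAt (fun q => r q * f q) z := by
  obtain ⟨a, b, h⟩ := hf
  refine ⟨w.re • a - w.im • b, w.im • a + w.re • b, fun J => ?_⟩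
  have e : (J : ℍ[ℝ]) * (J * b) = -b := by rw [← mul_assoc, imagUnit_mul_self, neg_one_mul]
  change r (cx J z) * f (cx J z) = _
  rw [hr, h, cx_apply, Quaternion.mul_coe_eq_smul, add_mul, Quaternion.coe_mul_eq_smul,
    smul_mul_assoc, mul_add, mul_add, e, mul_smul_comm, mul_smul_comm]
  module

/-- The coefficients of `f^s` on a sphere are the reals `|a|² - |b|²` and `2 Re(a b̄)`, so `f^s`
maps every line into itself. -/
theorem exists_symmetrization_cx {f : ℍ[ℝ] → ℍ[ℝ]} {z : ℂ} (hz : z.im ≠ 0) (hf : AffineAt f z) :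
    ∃ w : ℂ, ∀ J : imagUnits, symmetrization f (cx J z) = cx J w := by
  obtain ⟨a, b, h⟩ := hf
  refine ⟨⟨Quaternion.normSq a - Quaternion.normSq b, 2 * (a * star b).re⟩, fun J => ?_⟩
  rw [symmetrization, starMul_cx hz h (regConj_cx hz h), cx_apply, Quaternion.self_mul_star,
    Quaternion.self_mul_star]
  have e : a * star b + b * star a = ((2 * (a * star b).re : ℝ) : ℍ[ℝ]) := by
    rw [Quaternion.coe_mul, show ((2 : ℝ) : ℍ[ℝ]) = 2 from rfl, ← Quaternion.self_add_star, star_mul,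
      star_star]
  rw [e, Quaternion.coe_sub]

theorem AffineAt.regInv {f : ℍ[ℝ] → ℍ[ℝ]} {z : ℂ} (hf : AffineAt f z) :
    AffineAt (SliceRegular.regInv f) z := by
  by_cases hz : z.im = 0
  · exact affineAt_of_im_eq_zero _ hz
  · obtain ⟨w, hw⟩ := exists_symmetrization_cx hz hf
    obtain ⟨a, b, h⟩ := hf
    exact affineAt_cx_mul (r := fun q => (symmetrization f q)⁻¹) (w := w⁻¹)
      (fun J => by rw [hw J, map_inv₀]) ⟨_, _, regConj_cx hz h⟩

theorem affineAt_poleFactor (p : ℍ[ℝ]) (m n : ℕ) (z : ℂ) : AffineAt (poleFactor p m n) z :=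
  ((affineAt_starPow_sub _ z m).starMul (affineAt_starPow_sub _ z n)).regInv

/-! ### The `*`-product with functions that preserve a slice -/

section preserving

variable {I : imagUnits} {h : ℍ[ℝ] → ℍ[ℝ]} {F : ℂ → ℂ}

/-- The coefficients `α, β` of `h` lie in the commutative field `ℝ + Iℝ`, so `I` may be moved past
them and the `*`-product collapses to a pointwise one. Only the values of `h` at `z` and `z̄` are
assumed to lie on the line, which suits factors that are meaningless at some points. -/
theorem starMul_of_preserves_at {z A B : ℂ} (hA : h (cx I z) = cx I A)
    (hB : h (cx I (star z)) = cx I B) (g : ℍ[ℝ] → ℍ[ℝ]) :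
    starMul h g (cx I z) = cx I A * g (cx I z) := by
  have half : ∀ q : ℍ[ℝ], (1 / 2 : ℝ) • q = cx I (1 / 2) * q := fun q => by
    rw [show ((1 / 2 : ℂ)) = ((1 / 2 : ℝ) : ℂ) by push_cast; rfl, cx_ofReal,
      Quaternion.coe_mul_eq_smul]
  have hu : imUnit (cx I z) = cx I ((|z.im|⁻¹ * z.im : ℝ) * Complex.I) := by
    rw [imUnit_cx, map_mul, cx_ofReal, cx_I, Quaternion.coe_mul_eq_smul]
  -- Here `e` is the coordinate of `imUnit`: `±i` off the real axis and `0` on it. One expansion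
  -- serves both cases.
  have key : ∀ e : ℂ, (e * e = -1 ∨ (e = 0 ∧ star z = z)) → imUnit (cx I z) = cx I e →
      starMul h g (cx I z) = cx I A * g (cx I z) := by
    intro e he hue
    rw [starMul, stemRe, stemRe, stemIm, stemIm, star_cx, hA, hB, hue, half, half, half, half]
    set G := g (cx I z)
    set G' := g (cx I (star z))
    have e1 : cx I (1 / 2) * (cx I A + cx I B) = cx I ((A + B) / 2) := by
      rw [← map_add, ← map_mul]; congr 1; ring
    have e2 : -(cx I e * (cx I (1 / 2) * (cx I A - cx I B))) = cx I (-(e * (A - B) / 2)) := by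
      rw [← map_sub, ← map_mul, ← map_mul, ← map_neg]; congr 1; ring
    rw [e1, e2]
    -- The terms in `g z` and `g z̄` are separated; the coefficient of the latter carries the factor
    -- `1 + e²`.
    have e3 : ∀ u v : ℂ, cx I u * (cx I (1 / 2) * (G + G')) -
        cx I v * -(cx I e * (cx I (1 / 2) * (G - G'))) +
        cx I e * (cx I u * -(cx I e * (cx I (1 / 2) * (G - G'))) +
          cx I v * (cx I (1 / 2) * (G + G'))) =
        cx I ((u + 2 * (e * v) - e * e * u) / 2) * G + cx I ((u + e * e * u) / 2) * G' := by
      intro u v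
      have a1 : (u + 2 * (e * v) - e * e * u) / 2 = u * (1 / 2) + v * (e * (1 / 2)) +
        e * (v * (1 / 2)) - e * (u * (e * (1 / 2))) := by ring
      have a2 : (u + e * e * u) / 2 = u * (1 / 2) - v * (e * (1 / 2)) +
        e * (v * (1 / 2)) + e * (u * (e * (1 / 2))) := by ring
      rw [a1, a2]
      simp only [map_add, map_sub, map_mul]
      noncomm_ring
    rw [e3]
    rcases he with he | ⟨he, hz⟩
    · have b1 : ((A + B) / 2 + 2 * (e * (-(e * (A - B) / 2))) - e * e * ((A + B) / 2)) / 2 = A := by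
        linear_combination (-(A - B) / 2 - (A + B) / 4) * he
      have b2 : ((A + B) / 2 + e * e * ((A + B) / 2)) / 2 = 0 := by
        linear_combination ((A + B) / 4) * he
      rw [b1, b2, map_zero, zero_mul, add_zero]
    · have hG : G' = G := by simp only [G, G', hz]
      have hBA : B = A := cx_injective I (by rw [← hA, ← hB, hz])
      rw [hG, hBA, he, ← add_mul, ← map_add]
      congr 2
      ring
  by_cases hz : z.im = 0
  · refine key 0 (Or.inr ⟨rfl, ?_⟩) ?_
    · apply Complex.ext <;> simp [hz]
    · rw [hu, hz]; simp
  · refine key _ (Or.inl ?_) hu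
    have ht := abs_inv_mul_self_mul_self hz
    rw [mul_mul_mul_comm, Complex.I_mul_I, ← Complex.ofReal_mul, ht]
    simp

theorem starMul_of_preserves (hF : ∀ z, h (cx I z) = cx I (F z)) (g : ℍ[ℝ] → ℍ[ℝ]) (z : ℂ) :
    starMul h g (cx I z) = cx I (F z) * g (cx I z) :=
  starMul_of_preserves_at (hF z) (hF _) g

theorem regConj_of_preserves (hF : ∀ z, h (cx I z) = cx I (F z)) (z : ℂ) :
    regConj h (cx I z) = cx I (star (F (star z))) := by
  by_cases hz : z.im = 0
  · have hs : star z = z := by apply Complex.ext <;> simp [hz]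
    rw [regConj, stemRe, stemIm, imUnit_cx, hz, star_cx, hs, hF, ← star_cx]
    simp only [mul_zero, zero_smul, zero_mul, add_zero]
    congr 1
    module
  · have ht := abs_inv_mul_self_mul_self hz
    rw [regConj, stemRe, stemIm, imUnit_cx, star_cx, hF, hF]
    set t := |z.im|⁻¹ * z.im
    simp only [star_neg, star_mul, Quaternion.star_smul, star_imagUnit I.2, star_add, star_sub,
      star_cx, mul_neg]
    have e : (I : ℍ[ℝ]) * ((cx I (star (F z)) - cx I (star (F (star z)))) * I) =
        -(cx I (star (F z)) - cx I (star (F (star z)))) := by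
      rw [← map_sub, ← mul_assoc, coe_mul_comm_cx, mul_assoc, imagUnit_mul_self, mul_neg_one]
    simp only [mul_neg, smul_mul_assoc, mul_smul_comm, e]
    generalize hD : cx I (star (F z)) - cx I (star (F (star z))) = D
    rw [← sub_eq_iff_eq_add'.mpr (sub_eq_iff_eq_add.mp hD)]
    linear_combination (norm := module) (-(1 / 2 : ℝ) * ht) • D

/-- On the line `h^s` is `F(z) conj F(z̄)` and `h^c` is `conj F(z̄)`, so only the second factor has
to be cancelled. If `F z = 0`, both sides are `0` by the convention for inverses. -/
theorem regInv_of_preserves (hF : ∀ z, h (cx I z) = cx I (F z)) {z : ℂ} (hz : F (star z) ≠ 0) :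
    regInv h (cx I z) = cx I (F z)⁻¹ := by
  rw [regInv, symmetrization, starMul_of_preserves hF, regConj_of_preserves hF, ← map_mul,
    ← map_inv₀, ← map_mul]
  have : star (F (star z)) ≠ 0 := star_ne_zero.mpr hz
  congr 1
  field_simp

end preserving

theorem starPow_sub_cx (I : imagUnits) (z₀ : ℂ) (n : ℕ) (z : ℂ) :
    starPow (fun q => q - cx I z₀) n (cx I z) = cx I ((z - z₀) ^ n) := by
  induction n generalizing z with
  | zero => simp [starPow]
  | succ n ih =>
    rw [starPow, starMul_of_preserves ih, pow_succ, map_mul, map_sub]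

theorem linZPow_cx (I : imagUnits) {z₀ z : ℂ} (hz : z ≠ star z₀) (k : ℤ) :
    linZPow (cx I z₀) k (cx I z) = cx I ((z - z₀) ^ k) := by
  cases k with
  | ofNat n => simpa [linZPow] using starPow_sub_cx I z₀ n z
  | negSucc n =>
    rw [linZPow, regInv_of_preserves (starPow_sub_cx I z₀ (n + 1)), zpow_negSucc]
    refine pow_ne_zero _ (sub_ne_zero.mpr fun h => hz ?_)
    rw [← h, star_star]

theorem poleFactor_cx (I : imagUnits) {z₀ z : ℂ} (hz : z ≠ z₀) (hz' : z ≠ star z₀) (m n : ℕ) :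
    poleFactor (cx I z₀) m n (cx I z) = cx I ((z - z₀) ^ m * (z - star z₀) ^ n)⁻¹ := by
  have h : ∀ z, starMul (starPow (fun q => q - cx I z₀) m)
      (starPow (fun q => q - star (cx I z₀)) n) (cx I z) =
        cx I ((z - z₀) ^ m * (z - star z₀) ^ n) := fun z => by
    rw [starMul_of_preserves (starPow_sub_cx I z₀ m), star_cx, starPow_sub_cx, map_mul]
  rw [poleFactor, regInv_of_preserves h]
  refine mul_ne_zero (pow_ne_zero _ (sub_ne_zero.mpr fun h => hz' ?_))
    (pow_ne_zero _ (sub_ne_zero.mpr fun h => hz (star_injective h)))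
  rw [← h, star_star]

theorem starMul_poleFactor_cx (I : imagUnits) {z₀ z : ℂ} (hz : z ≠ z₀) (hz' : z ≠ star z₀)
    (m n : ℕ) (g : ℍ[ℝ] → ℍ[ℝ]) :
    starMul (poleFactor (cx I z₀) m n) g (cx I z) =
      cx I ((z - z₀) ^ m * (z - star z₀) ^ n)⁻¹ * g (cx I z) := by
  refine starMul_of_preserves_at (poleFactor_cx I hz hz' m n)
    (poleFactor_cx I (fun h => hz' ?_) (fun h => hz (star_injective h)) m n) g
  rw [← h, star_star]

/-! ### Regularity as complex differentiability -/

/-- The identity map from `V I` to `ℍ` as a real-linear map. -/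
def ofVCLM (I : imagUnits) : V I →L[ℝ] ℍ[ℝ] where
  toFun := (toV I).symm
  map_add' := map_add _
  map_smul' r h := by
    obtain ⟨k, rfl⟩ := (toV I).surjective h
    rw [← Complex.coe_smul, smul_toV, AddEquiv.symm_apply_apply, AddEquiv.symm_apply_apply,
      cx_ofReal, Quaternion.coe_mul_eq_smul, RingHom.id_apply]
  cont := (isometry_toV_symm I).continuous

theorem restrictSlice_eq (f : ℍ[ℝ] → ℍ[ℝ]) (I : imagUnits) :
    restrictSlice f I = fun v => f (cx I (Complex.equivRealProdCLM.symm v)) := by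
  ext1 v
  rw [cx_apply, Complex.equivRealProdCLM_symm_apply_re, Complex.equivRealProdCLM_symm_apply_im,
    restrictSlice]

theorem sliceCoords_eq (Ω : Set ℍ[ℝ]) (I : imagUnits) :
    sliceCoords Ω I = {v | cx I (Complex.equivRealProdCLM.symm v) ∈ Ω} := by
  ext v
  rw [mem_ofPred_eq, cx_apply, Complex.equivRealProdCLM_symm_apply_re,
    Complex.equivRealProdCLM_symm_apply_im]
  rfl

theorem isOpen_cx_preimage {Ω : Set ℍ[ℝ]} (hΩ : IsOpen Ω) (I : imagUnits) :
    IsOpen {z | cx I z ∈ Ω} :=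
  hΩ.preimage (continuous_cx I)

theorem hasFDerivAt_of_restrictSlice {f : ℍ[ℝ] → ℍ[ℝ]} {I : imagUnits} {z : ℂ}
    {L : ℝ × ℝ →L[ℝ] ℍ[ℝ]}
    (h : HasFDerivAt (restrictSlice f I) L (Complex.equivRealProdCLM z))
    (hL : L (1, 0) + I * L (0, 1) = 0) :
    HasFDerivAt (𝕜 := ℝ) (fun w => f (cx I w)) (mulRightCLM I (L (1, 0))) z := by
  have h2 := h.comp z Complex.equivRealProdCLM.hasFDerivAt
  have e : (restrictSlice f I ∘ Complex.equivRealProdCLM) = fun w => f (cx I w) := by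
    rw [restrictSlice_eq]
    ext1 w
    simp only [Function.comp_apply, ContinuousLinearEquiv.symm_apply_apply]
  rw [e] at h2
  refine h2.congr_fderiv ?_
  ext1 w
  have e1 : L (0, 1) = I * L (1, 0) := by
    rw [eq_neg_of_add_eq_zero_left hL, mul_neg, ← mul_assoc, imagUnit_mul_self]; simp
  have e2 : Complex.equivRealProdCLM w = w.re • ((1 : ℝ), (0 : ℝ)) + w.im • ((0 : ℝ), (1 : ℝ)) := by
    rw [Complex.equivRealProdCLM_apply]; simp
  rw [ContinuousLinearMap.comp_apply, mulRightCLM_apply, ContinuousLinearEquiv.coe_coe, e2, map_add,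
    map_smul, map_smul, e1, cx_apply, add_mul, Quaternion.coe_mul_eq_smul,
    Quaternion.mul_coe_eq_smul, smul_mul_assoc]

theorem hasFDerivAt_restrictSlice {f : ℍ[ℝ] → ℍ[ℝ]} {I : imagUnits} {v : ℝ × ℝ} {d : ℍ[ℝ]}
    (h : HasFDerivAt (𝕜 := ℝ) (fun w => f (cx I w)) (mulRightCLM I d)
      (Complex.equivRealProdCLM.symm v)) :
    HasFDerivAt (restrictSlice f I)
      ((mulRightCLM I d).comp (Complex.equivRealProdCLM.symm : ℝ × ℝ →L[ℝ] ℂ)) v := by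
  rw [restrictSlice_eq]
  exact h.comp v Complex.equivRealProdCLM.symm.hasFDerivAt

/-- The regularity equation says that the real derivative is `w ↦ w d`, that is, complex linear. In
the converse direction `C¹` is automatic, since holomorphic functions are smooth. -/
theorem regularOn_iff {f : ℍ[ℝ] → ℍ[ℝ]} {Ω : Set ℍ[ℝ]} (hΩ : IsOpen Ω) :
    RegularOn f Ω ↔
      ∀ (I : imagUnits) (z : ℂ), cx I z ∈ Ω → DifferentiableAt ℂ (sliceFn f I) z := by
  have hopen : ∀ I : imagUnits, IsOpen (sliceCoords Ω I) := fun I => by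
    rw [sliceCoords_eq]
    exact hΩ.preimage ((continuous_cx I).comp Complex.equivRealProdCLM.symm.continuous)
  constructor
  · intro h I z hz
    have hv : Complex.equivRealProdCLM z ∈ sliceCoords Ω I := by
      rw [sliceCoords_eq, mem_ofPred_eq, ContinuousLinearEquiv.symm_apply_apply]; exact hz
    have h1 := (((h I I.2).1.differentiableOn one_ne_zero).differentiableAt
      ((hopen I).mem_nhds hv)).hasFDerivAt
    exact differentiableAt_toV_iff.mpr ⟨_, hasFDerivAt_of_restrictSlice h1 ((h I I.2).2 _ hv)⟩
  · intro h I hI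
    have h' := h ⟨I, hI⟩
    refine ⟨?_, fun v hv => ?_⟩
    · have h1 : DifferentiableOn ℂ (sliceFn f ⟨I, hI⟩) {z | cx ⟨I, hI⟩ z ∈ Ω} := fun z hz =>
        (h' z hz).differentiableWithinAt
      have h2 := (h1.contDiffOn (n := 1) (isOpen_cx_preimage hΩ _)).restrict_scalars ℝ
      have h3 := (ofVCLM ⟨I, hI⟩).contDiff.comp_contDiffOn h2
      have h4 := h3.comp (Complex.equivRealProdCLM.symm.contDiff (n := 1)).contDiffOn
        (s := sliceCoords Ω I) (fun v hv => by
          have := sliceCoords_eq Ω ⟨I, hI⟩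
          simp only at this
          rw [this] at hv
          exact hv)
      have e := restrictSlice_eq f ⟨I, hI⟩
      simp only at e
      rw [e]
      exact h4
    · have hv' : v ∈ sliceCoords Ω (⟨I, hI⟩ : imagUnits) := hv
      rw [sliceCoords_eq] at hv'
      obtain ⟨d, hd⟩ := differentiableAt_toV_iff.mp (h' _ hv')
      have := (hasFDerivAt_restrictSlice hd).fderiv
      simp only at this
      rw [this]
      simp only [ContinuousLinearMap.comp_apply, ContinuousLinearEquiv.coe_coe, mulRightCLM_apply]
      have e1 : Complex.equivRealProdCLM.symm ((1 : ℝ), (0 : ℝ)) = 1 := by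
        apply Complex.ext <;> simp
      have e2 : Complex.equivRealProdCLM.symm ((0 : ℝ), (1 : ℝ)) = Complex.I := by
        apply Complex.ext <;> simp
      rw [e1, e2, map_one, one_mul, cx_I, ← mul_assoc, imagUnit_mul_self ⟨I, hI⟩, neg_one_mul,
        add_neg_cancel]

/-! ### The representation formula for regular functions. -/

/-- The elements `1 - JI` and `1 + JI` intertwine multiplication by `w` on line `J` with
multiplication by `w`, respectively `w̄`, on line `I`. This is why `rep` turns a holomorphic and an
antiholomorphic function on `I` into a holomorphic one on `J`. -/
theorem cx_mul_rep (I J : imagUnits) (w : ℂ) (A B : ℍ[ℝ]) :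
    cx J w * rep I J A B = rep I J (cx I w * A) (cx I (star w) * B) := by
  have hJ : (J : ℍ[ℝ]) * (J * I) = -I := by rw [← mul_assoc, imagUnit_mul_self, neg_one_mul]
  have e1 : (1 - (J : ℍ[ℝ]) * I) * cx I w = cx J w * (1 - J * I) := by
    rw [cx_apply, cx_apply, Quaternion.mul_coe_eq_smul, Quaternion.mul_coe_eq_smul]
    rw [mul_add, add_mul, Quaternion.coe_mul_eq_smul, Quaternion.mul_coe_eq_smul,
      mul_smul_comm, smul_mul_assoc, sub_mul, mul_sub, mul_assoc, imagUnit_mul_self, hJ]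
    simp only [one_mul, mul_one, mul_neg, sub_neg_eq_add]
    rw [add_comm (I : ℍ[ℝ])]
  have e2 : (1 + (J : ℍ[ℝ]) * I) * cx I (star w) = cx J w * (1 + J * I) := by
    rw [cx_apply, cx_apply, Quaternion.mul_coe_eq_smul, Quaternion.mul_coe_eq_smul]
    simp only [mul_add, add_mul, Quaternion.coe_mul_eq_smul, Quaternion.mul_coe_eq_smul,
      mul_smul_comm, smul_mul_assoc, mul_assoc, imagUnit_mul_self, hJ, one_mul, mul_one, mul_neg,
      Complex.star_def, Complex.conj_re, Complex.conj_im]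
    module
  rw [rep, rep, mul_smul_comm, mul_add, ← mul_assoc, ← mul_assoc, ← e1, ← e2, mul_assoc, mul_assoc]

theorem differentiableAt_rep {I : imagUnits} {γ₁ γ₂ : ℂ → ℍ[ℝ]} {z : ℂ}
    (h₁ : DifferentiableAt ℂ (fun w => toV I (γ₁ w)) z)
    (h₂ : DifferentiableAt ℂ (fun w => toV I (γ₂ w)) (star z)) (J : imagUnits) :
    DifferentiableAt ℂ (fun w => toV J (rep I J (γ₁ w) (γ₂ (star w)))) z := by
  obtain ⟨d₁, h₁⟩ := differentiableAt_toV_iff.mp h₁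
  obtain ⟨d₂, h₂⟩ := differentiableAt_toV_iff.mp h₂
  have h₃ := HasFDerivAt.comp (f := fun w : ℂ => star w) z h₂
    (Complex.conjCLE : ℂ ≃L[ℝ] ℂ).hasFDerivAt
  refine differentiableAt_toV_iff.mpr ⟨rep I J d₁ d₂, ?_⟩
  have h₄ := ((h₁.const_mul (1 - (J : ℍ[ℝ]) * I)).add
    (h₃.const_mul (1 + (J : ℍ[ℝ]) * I))).const_smul (1 / 2 : ℝ)
  refine h₄.congr_fderiv ?_
  ext1 w
  change (1 / 2 : ℝ) • ((1 - (J : ℍ[ℝ]) * I) * (cx I w * d₁) +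
    (1 + (J : ℍ[ℝ]) * I) * (cx I (star w) * d₂)) = cx J w * rep I J d₁ d₂
  exact (cx_mul_rep I J w d₁ d₂).symm

theorem IsSliceDomain.isPreconnected_cx {Ω : Set ℍ[ℝ]} (hΩ : IsSliceDomain Ω) (I : imagUnits) :
    IsPreconnected {z | cx I z ∈ Ω} := by
  have e : cx I '' {z | cx I z ∈ Ω} = Ω ∩ slice I := by
    rw [← range_cx]
    exact image_preimage_eq_inter_range
  rw [← (isometry_cx I).isEmbedding.isInducing.isPreconnected_image, e]
  exact (hΩ.slice_connected I I.2).isPreconnected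

/-- On line `J`, both `f` and the `rep` of its values on line `I` are holomorphic. They agree on the
real points near `r`, hence on the whole connected slice. -/
theorem RegularOn.affineAt {f : ℍ[ℝ] → ℍ[ℝ]} {Ω : Set ℍ[ℝ]} (hΩ : IsSymmetricSliceDomain Ω)
    (hf : RegularOn f Ω) {I : imagUnits} {z : ℂ} (hz : cx I z ∈ Ω) : AffineAt f z := by
  refine affineAt_of_rep I (A := f (cx I z)) (B := f (cx I (star z))) fun J => ?_
  rw [regularOn_iff hΩ.isOpen] at hf
  obtain ⟨r, hr⟩ := hΩ.meets_real
  have hD : IsOpen {z | cx J z ∈ Ω} := isOpen_cx_preimage hΩ.isOpen J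
  have h1 : AnalyticOnNhd ℂ (sliceFn f J) {z | cx J z ∈ Ω} :=
    DifferentiableOn.analyticOnNhd (fun w hw => (hf J w hw).differentiableWithinAt) hD
  have h2 : AnalyticOnNhd ℂ (fun w => toV J (rep I J (f (cx I w)) (f (cx I (star w)))))
      {z | cx J z ∈ Ω} :=
    DifferentiableOn.analyticOnNhd (fun w hw => (differentiableAt_rep
      (γ₁ := fun w => f (cx I w)) (γ₂ := fun w => f (cx I w)) (hf I w (hΩ.symmetric.cx_mem hw I))
      (hf I _ (hΩ.symmetric.cx_star_mem hw I)) J).differentiableWithinAt) hD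
  have hr' : (r : ℂ) ∈ {z | cx J z ∈ Ω} := by rw [mem_ofPred_eq, cx_ofReal]; exact hr
  have hT : Tendsto (fun t : ℝ => (t : ℂ)) (𝓝[≠] r) (𝓝[≠] (r : ℂ)) :=
    Complex.continuous_ofReal.continuousWithinAt.tendsto_nhdsWithin
      fun t ht => fun h => ht (Complex.ofReal_injective h)
  have h3 := h1.eqOn_of_preconnected_of_frequently_eq h2
    (hΩ.toIsSliceDomain.isPreconnected_cx J) hr'
    (hT.frequently (Eventually.of_forall fun t => by
      have hs : star (t : ℂ) = t := Complex.conj_ofReal t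
      rw [hs, rep_diag, sliceFn, cx_ofReal, cx_ofReal]).frequently)
  exact (toV J).injective (h3 (hΩ.symmetric.cx_mem hz J))

/-! ### Extension of holomorphic functions from a slice -/

/-- The slice function with the restriction `γ` to the line `ℝ + Iℝ`. -/
def sliceExt (I : imagUnits) (γ : ℂ → ℍ[ℝ]) (q : ℍ[ℝ]) : ℍ[ℝ] :=
  rep I (exists_cx_upperCoord I q).choose (γ (upperCoord q)) (γ (star (upperCoord q)))

theorem cx_unit_injective {J K : imagUnits} {z : ℂ} (hz : z.im ≠ 0) (h : cx J z = cx K z) :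
    J = K := by
  have := congrArg (fun q : ℍ[ℝ] => q.im) h
  simp only [im_cx] at this
  exact Subtype.ext (smul_right_injective _ hz this)

/-- The chosen coordinate is `z` with unit `J` or `z̄` with unit `-J`, and changing the sign of the
unit swaps the two values in `rep`. At a real point the two values coincide and the unit is
immaterial. -/
theorem sliceExt_cx (I J : imagUnits) (γ : ℂ → ℍ[ℝ]) (z : ℂ) :
    sliceExt I γ (cx J z) = rep I J (γ z) (γ (star z)) := by
  rw [sliceExt]
  obtain ⟨hK, -⟩ := (exists_cx_upperCoord I (cx J z)).choose_spec
  generalize (exists_cx_upperCoord I (cx J z)).choose = K at hK ⊢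
  by_cases hz : z.im = 0
  · have hs : star z = z := by apply Complex.ext <;> simp [hz]
    have hu : upperCoord (cx J z) = z := by
      rcases upperCoord_cx J z with h | h <;> simp only [h, hs]
    rw [hu, hs, rep_diag, rep_diag]
  · rcases upperCoord_cx J z with h | h
    · rw [h] at hK ⊢
      rw [cx_unit_injective hz hK]
    · rw [h] at hK ⊢
      rw [cx_star] at hK
      rw [← cx_unit_injective hz hK, rep_negUnit, star_star]

theorem sliceExt_cx_self (I : imagUnits) (γ : ℂ → ℍ[ℝ]) (z : ℂ) :
    sliceExt I γ (cx I z) = γ z := by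
  rw [sliceExt_cx, rep_self_left]

theorem regularOn_sliceExt {I : imagUnits} {γ : ℂ → ℍ[ℝ]} {Ω : Set ℍ[ℝ]} (hΩ : IsOpen Ω)
    (hs : IsAxiallySymmetric Ω)
    (h : ∀ z, cx I z ∈ Ω → DifferentiableAt ℂ (fun w => toV I (γ w)) z) :
    RegularOn (sliceExt I γ) Ω := by
  rw [regularOn_iff hΩ]
  intro J z hz
  have e : sliceFn (sliceExt I γ) J = fun w => toV J (rep I J (γ w) (γ (star w))) := by
    ext1 w; rw [sliceFn, sliceExt_cx]
  rw [e]
  exact differentiableAt_rep (h z (hs.cx_mem hz I)) (h _ (hs.cx_star_mem hz I)) J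

theorem AffineAt.of_sliceExt (I : imagUnits) (γ : ℂ → ℍ[ℝ]) (z : ℂ) :
    AffineAt (sliceExt I γ) z :=
  affineAt_of_rep I fun J => sliceExt_cx I J γ z

/-! ### Poles of holomorphic functions -/

section PoleLE

variable {E : Type*} [NormedAddCommGroup E] [NormedSpace ℂ E]

/-- `(z - z₀) ^ m • φ z` extends to an analytic function at `z₀`. -/
def PoleLE (φ : ℂ → E) (z₀ : ℂ) (m : ℕ) : Prop :=
  ∃ G : ℂ → E, AnalyticAt ℂ G z₀ ∧ ∀ᶠ z in 𝓝[≠] z₀, G z = (z - z₀) ^ m • φ z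

theorem PoleLE.mono {φ : ℂ → E} {z₀ : ℂ} {m n : ℕ} (h : PoleLE φ z₀ m) (hmn : m ≤ n) :
    PoleLE φ z₀ n := by
  obtain ⟨G, hG, he⟩ := h
  refine ⟨fun z => (z - z₀) ^ (n - m) • G z, by fun_prop, ?_⟩
  filter_upwards [he] with z hz
  rw [hz, smul_smul, ← pow_add, Nat.sub_add_cancel hmn]

theorem PoleLE.congr {φ ψ : ℂ → E} {z₀ : ℂ} {m : ℕ} (h : PoleLE φ z₀ m) (he : φ =ᶠ[𝓝[≠] z₀] ψ) :
    PoleLE ψ z₀ m := by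
  obtain ⟨G, hG, hG'⟩ := h
  refine ⟨G, hG, ?_⟩
  filter_upwards [hG', he] with z hz hz'
  rw [hz, hz']

theorem PoleLE.smul {φ : ℂ → E} {z₀ : ℂ} {m : ℕ} (h : PoleLE φ z₀ m) {u : ℂ → ℂ}
    (hu : AnalyticAt ℂ u z₀) : PoleLE (fun z => u z • φ z) z₀ m := by
  obtain ⟨G, hG, hG'⟩ := h
  refine ⟨fun z => u z • G z, hu.smul hG, ?_⟩
  filter_upwards [hG'] with z hz
  rw [hz, smul_comm]

theorem poleLE_zero_of_analyticAt {φ : ℂ → E} {z₀ : ℂ} (h : AnalyticAt ℂ φ z₀) : PoleLE φ z₀ 0 :=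
  ⟨φ, h, Eventually.of_forall fun z => by rw [pow_zero, one_smul]⟩

/-- The divided difference `dslope G z₀` is analytic and removes one factor `z - z₀`. -/
theorem PoleLE.of_eq_zero {φ G : ℂ → E} {z₀ : ℂ} {m : ℕ} (hG : AnalyticAt ℂ G z₀)
    (he : ∀ᶠ z in 𝓝[≠] z₀, G z = (z - z₀) ^ (m + 1) • φ z) (h0 : G z₀ = 0) : PoleLE φ z₀ m := by
  obtain ⟨p, hp⟩ := hG
  refine ⟨dslope G z₀, ⟨_, hp.has_fpower_series_dslope_fslope⟩, ?_⟩
  filter_upwards [he, self_mem_nhdsWithin] with z hz hne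
  have hne' : z - z₀ ≠ 0 := sub_ne_zero.mpr hne
  rw [dslope_of_ne _ hne, slope_def_module, h0, sub_zero, hz, smul_smul, pow_succ', ← mul_assoc,
    inv_mul_cancel₀ hne', one_mul]

theorem eventually_ne_of_nhdsNE (a b : ℂ) : ∀ᶠ z in 𝓝[≠] a, z ≠ b := by
  by_cases h : b = a
  · rw [h]; exact self_mem_nhdsWithin
  · exact eventually_nhdsWithin_of_eventually_nhds (isOpen_ne.mem_nhds (Ne.symm h))

theorem PoleLE.of_hasSum {φ : ℂ → E} {z₀ : ℂ} {m : ℕ} {a : ℤ → E}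
    (h : ∀ᶠ z in 𝓝[≠] z₀, HasSum (fun k : ℤ => (z - z₀) ^ k • a k) (φ z))
    (ha : ∀ k : ℕ, m < k → a (-(k : ℤ)) = 0) : PoleLE φ z₀ m := by
  -- Multiplication by `(z - z₀)^m` shifts indices by `m` and turns the Laurent series into a power
  -- series; its constant term is the value to assign at `z₀`.
  set b : ℕ → E := fun j => a ((j : ℤ) - m) with hb
  set G : ℂ → E := Function.update (fun z => (z - z₀) ^ m • φ z) z₀ (b 0) with hG
  have hs : ∀ᶠ z in 𝓝 z₀, HasSum (fun j : ℕ => (z - z₀) ^ j • b j) (G z) := by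
    rw [eventually_nhdsWithin_iff] at h
    filter_upwards [h] with z hz
    by_cases hne : z = z₀
    · subst hne
      rw [hG, Function.update_self]
      convert! hasSum_single (f := fun j : ℕ => (z - z) ^ j • b j) 0 (fun j hj => ?_) using 1
      · simp
      · simp [hj]
    · rw [hG, Function.update_of_ne hne]
      have hne' : z - z₀ ≠ 0 := sub_ne_zero.mpr hne
      have h1 := (hz hne).const_smul ((z - z₀) ^ m)
      have hinj : Function.Injective fun j : ℕ => (j : ℤ) - m := fun i j hij => by
        simpa using hij
      rw [← hinj.hasSum_iff] at h1
      · refine h1.congr_fun ?_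
        intro j
        simp only [Function.comp_apply, hb]
        rw [smul_smul, ← zpow_natCast, ← zpow_natCast, ← zpow_add₀ hne']
        congr 2
        ring
      · intro k hk
        have : k < -m := by
          by_contra hk'
          exact hk ⟨(k + m).toNat, by simp only; omega⟩
        obtain ⟨l, hl⟩ : ∃ l : ℕ, k = -(l : ℤ) := ⟨k.natAbs, by omega⟩
        rw [hl, ha l (by omega), smul_zero, smul_zero]
  let p : FormalMultilinearSeries ℂ ℂ E := fun j =>
    ContinuousMultilinearMap.mkPiRing ℂ (Fin j) (b j)
  have hp : ∀ j, p.coeff j = b j := fun j => by simp [p, FormalMultilinearSeries.coeff]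
  refine ⟨G, ⟨p, hasFPowerSeriesAt_iff'.mpr ?_⟩, ?_⟩
  · simpa only [hp] using hs
  · filter_upwards [self_mem_nhdsWithin] with z hz
    rw [hG, Function.update_of_ne hz]

theorem PoleLE.exists_hasSum {φ : ℂ → E} {z₀ : ℂ} {m : ℕ} (h : PoleLE φ z₀ m) :
    ∃ a : ℤ → E, (∀ᶠ z in 𝓝[≠] z₀, HasSum (fun k : ℤ => (z - z₀) ^ k • a k) (φ z)) ∧
      ∀ k : ℕ, m < k → a (-(k : ℤ)) = 0 := by
  obtain ⟨G, ⟨p, hp⟩, he⟩ := h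
  rw [hasFPowerSeriesAt_iff'] at hp
  refine ⟨fun k => if 0 ≤ k + m then p.coeff (k + m).toNat else 0, ?_, fun k hk => ?_⟩
  · filter_upwards [he, eventually_nhdsWithin_of_eventually_nhds hp, self_mem_nhdsWithin]
      with z hz hsum hne
    have hne' : z - z₀ ≠ 0 := sub_ne_zero.mpr hne
    have h1 := hsum.const_smul ((z - z₀) ^ m)⁻¹
    rw [hz, smul_smul, inv_mul_cancel₀ (pow_ne_zero _ hne'), one_smul] at h1
    have hinj : Function.Injective fun j : ℕ => (j : ℤ) - m := fun i j hij => by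
      simpa using hij
    rw [← hinj.hasSum_iff]
    · refine h1.congr_fun ?_
      intro j
      simp only [Function.comp_apply, sub_add_cancel, Int.natCast_nonneg, if_true, Int.toNat_natCast]
      rw [smul_smul, zpow_sub₀ hne', zpow_natCast, zpow_natCast, div_eq_inv_mul]
    · intro k hk
      have : ¬ (0 ≤ k + m) := fun hk' => hk ⟨(k + m).toNat, by simp only; omega⟩
      rw [if_neg this, smul_zero]
  · exact if_neg (by omega)

end PoleLE

/-! ### The sets `Σ(p, 0, R)` -/

theorem cx_mem_sigmaShell (I : imagUnits) {z z₀ : ℂ} {R : ℝ} (hz : z ≠ z₀) (hR : ‖z - z₀‖ < R) :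
    cx I z ∈ sigmaShell (cx I z₀) 0 R := by
  have h : OnCommonSlice (cx I z) (cx I z₀) := by
    refine ⟨I, I.2, ?_, ?_⟩ <;> rw [← range_cx] <;> exact mem_range_self _
  rw [sigmaShell, mem_ofPred_eq, tau, sigma, if_pos h, if_pos h, ← map_sub, norm_cx]
  exact ⟨norm_pos_iff.mpr (sub_ne_zero.mpr hz), hR⟩

/-- Off the line of a non-real `p`, `sigma q p` is at least `|Im p|`, so a shell of radius at most
`|Im p|` is a punctured disc in that line. A real `p` lies on every line. -/
theorem exists_cx_of_mem_sigmaShell {I : imagUnits} {z₀ : ℂ} {R : ℝ} {q : ℍ[ℝ]}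
    (hq : q ∈ sigmaShell (cx I z₀) 0 R) (hR : z₀.im = 0 ∨ R ≤ |z₀.im|) :
    ∃ (J : imagUnits) (z : ℂ), q = cx J z ∧ z ≠ z₀ ∧ ‖z - z₀‖ < R ∧ (J = I ∨ z₀.im = 0) := by
  obtain ⟨h1, h2⟩ := hq
  have key : ∀ (J : imagUnits) (z : ℂ), q = cx J z → cx I z₀ = cx J z₀ → z ≠ z₀ ∧ ‖z - z₀‖ < R := by
    intro J z e1 e2
    have h : OnCommonSlice q (cx I z₀) := by
      rw [e1, e2]
      refine ⟨J, J.2, ?_, ?_⟩ <;> rw [← range_cx] <;> exact mem_range_self _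
    rw [tau, if_pos h, e1, e2, ← map_sub, norm_cx] at h1
    rw [sigma, if_pos h, e1, e2, ← map_sub, norm_cx] at h2
    exact ⟨sub_ne_zero.mp (norm_pos_iff.mp h1), h2⟩
  by_cases hz : z₀.im = 0
  · obtain ⟨J, z, hJ⟩ := exists_cx_eq I q
    obtain ⟨h3, h4⟩ := key J z hJ.symm (cx_eq_of_im_eq_zero I J hz)
    exact ⟨J, z, hJ.symm, h3, h4, Or.inr hz⟩
  · have hR := hR.resolve_left hz
    by_cases h : OnCommonSlice q (cx I z₀)
    · obtain ⟨K, hK, hq, hp⟩ := h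
      rw [← range_cx ⟨K, hK⟩] at hq hp
      obtain ⟨z, hz'⟩ := hq
      obtain ⟨w, hw⟩ := hp
      suffices ∃ z', q = cx I z' by
        obtain ⟨z', hz''⟩ := this
        obtain ⟨h3, h4⟩ := key I z' hz'' rfl
        exact ⟨I, z', hz'', h3, h4, Or.inl rfl⟩
      have hre := congrArg (fun q : ℍ[ℝ] => q.re) hw
      have him := congrArg (fun q : ℍ[ℝ] => ‖q.im‖) hw
      simp only [re_cx, norm_im_cx] at hre him
      rcases abs_eq_abs.mp him with h3 | h3
      · have : w = z₀ := Complex.ext hre h3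
        rw [this] at hw
        rw [← cx_unit_injective hz hw]
        exact ⟨z, hz'.symm⟩
      · have : w = star z₀ := by apply Complex.ext <;> simp [hre, h3]
        rw [this, cx_star] at hw
        have := cx_unit_injective hz hw
        refine ⟨star z, ?_⟩
        rw [← this, ← cx_star, star_star, hz']
    · rw [sigma, if_neg h, norm_im_cx] at h2
      have : |z₀.im| ≤ Real.sqrt ((q.re - (cx I z₀).re) ^ 2 + (‖q.im‖ + |z₀.im|) ^ 2) := by
        apply Real.le_sqrt_of_sq_le
        nlinarith [sq_nonneg (q.re - (cx I z₀).re), norm_nonneg q.im, abs_nonneg z₀.im]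
      linarith

theorem IsSingularity.eventually {Ω : Set ℍ[ℝ]} {I : imagUnits} {z₀ : ℂ}
    (h : IsSingularity Ω (cx I z₀)) : ∀ᶠ z in 𝓝[≠] z₀, cx I z ∈ Ω := by
  obtain ⟨R, hR, hs⟩ := h
  filter_upwards [eventually_nhdsWithin_of_eventually_nhds (Metric.ball_mem_nhds z₀ hR),
    self_mem_nhdsWithin] with z hz hne
  exact hs (cx_mem_sigmaShell I hne (by rwa [dist_eq_norm] at hz))

theorem exists_pos_im_condition (z₀ : ℂ) : ∃ r > 0, z₀.im = 0 ∨ r ≤ |z₀.im| := by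
  by_cases h : z₀.im = 0
  · exact ⟨1, one_pos, Or.inl h⟩
  · exact ⟨_, abs_pos.mpr h, Or.inr le_rfl⟩

theorem isSingularity_of_mem {Ω : Set ℍ[ℝ]} (hΩ : IsOpen Ω) {I : imagUnits} {z₀ : ℂ}
    (h : cx I z₀ ∈ Ω) : IsSingularity Ω (cx I z₀) := by
  obtain ⟨R, hR, hb⟩ := Metric.isOpen_iff.mp hΩ _ h
  obtain ⟨r, hr, hr'⟩ := exists_pos_im_condition z₀
  refine ⟨min R r, lt_min hR hr, fun q hq => hb ?_⟩
  obtain ⟨J, z, rfl, -, hz, hJ⟩ := exists_cx_of_mem_sigmaShell hq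
    (hr'.imp_right fun h => (min_le_right _ _).trans h)
  have : cx I z₀ = cx J z₀ := by
    rcases hJ with rfl | hJ
    · rfl
    · exact cx_eq_of_im_eq_zero _ _ hJ
  rw [mem_ball_iff_norm, this, ← map_sub, norm_cx]
  exact hz.trans_le (min_le_left _ _)

theorem affineAt_linZPow (p : ℍ[ℝ]) (k : ℤ) (z : ℂ) : AffineAt (linZPow p k) z := by
  cases k with
  | ofNat n => exact affineAt_starPow_sub p z n
  | negSucc n => exact (affineAt_starPow_sub p z (n + 1)).regInv

/-- On the line the expansion is an ordinary Laurent series. Conversely, a small shell around a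
non-real point stays in the line; around a real point the other lines are reached by applying the
representation formula term by term. -/
theorem poleOrderLE_iff {f : ℍ[ℝ] → ℍ[ℝ]} {Ω : Set ℍ[ℝ]} (hΩ : IsSymmetricSliceDomain Ω)
    (hf : RegularOn f Ω) {I : imagUnits} {z₀ : ℂ} {m : ℕ} :
    PoleOrderLE f Ω (cx I z₀) m ↔
      IsSingularity Ω (cx I z₀) ∧ PoleLE (sliceFn f I) z₀ m := by
  constructor
  · rintro ⟨a, ⟨R, hR, hs, hsum⟩, ha⟩
    refine ⟨⟨R, hR, hs⟩, PoleLE.of_hasSum (a := fun k => toV I (a k)) ?_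
      fun k hk => by rw [ha k hk, map_zero]⟩
    filter_upwards [eventually_nhdsWithin_of_eventually_nhds (Metric.ball_mem_nhds z₀ hR),
      self_mem_nhdsWithin, eventually_ne_of_nhdsNE z₀ (star z₀)] with z hz hne hne'
    have h1 := (hsum _ (cx_mem_sigmaShell I hne (by rwa [dist_eq_norm] at hz))).map (toV I)
      (isometry_toV I).continuous
    refine h1.congr_fun fun k => ?_
    rw [Function.comp_apply, linZPow_cx I hne', smul_toV]
  · rintro ⟨⟨R, hR, hs⟩, h⟩
    obtain ⟨a, hsum, ha⟩ := h.exists_hasSum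
    obtain ⟨r, hr, hr'⟩ := exists_pos_im_condition z₀
    obtain ⟨ε, hε, hb⟩ := Metric.mem_nhdsWithin_iff.mp
      (hsum.and (eventually_ne_of_nhdsNE z₀ (star z₀)))
    -- `R` keeps the shell in `Ω`, `r` keeps it in the line when `p` is not real, and `ε` ensures
    -- convergence and avoids `z̄₀`.
    refine ⟨fun k => (toV I).symm (a k), ⟨min R (min r ε), lt_min hR (lt_min hr hε), ?_, ?_⟩,
      fun k hk => by simp only [ha k hk, map_zero]⟩
    · exact fun q hq => hs ⟨hq.1, hq.2.trans_le (min_le_left _ _)⟩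
    · have key : ∀ z, z ≠ z₀ → ‖z - z₀‖ < min R (min r ε) →
          HasSum (fun k => linZPow (cx I z₀) k (cx I z) * (toV I).symm (a k)) (f (cx I z)) := by
        intro z hne hz
        have hz' : ‖z - z₀‖ < ε := hz.trans_le ((min_le_right _ _).trans (min_le_right _ _))
        obtain ⟨h1, h2⟩ := hb ⟨mem_ball_iff_norm.mpr hz', hne⟩
        have h3 := h1.map (toV I).symm (isometry_toV_symm I).continuous
        refine h3.congr_fun fun k => ?_
        rw [Function.comp_apply, linZPow_cx I h2]
        rfl
      intro q hq
      have hqΩ : q ∈ Ω := hs ⟨hq.1, hq.2.trans_le (min_le_left _ _)⟩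
      obtain ⟨J, z, rfl, hne, hz, hJ⟩ := exists_cx_of_mem_sigmaShell hq
        (hr'.imp_right fun h => ((min_le_right _ _).trans (min_le_left _ _)).trans h)
      rcases hJ with rfl | hJ
      · exact key z hne hz
      · have hs₀ : star z₀ = z₀ := by apply Complex.ext <;> simp [hJ]
        have h1 := key z hne hz
        have h2 := key (star z) (fun h => hne (star_injective (h.trans hs₀.symm))) (by
          have e : star z - z₀ = star (z - z₀) := by rw [star_sub, hs₀]
          rw [e, norm_star]; exact hz)
        have h3 := ((h1.mul_left (1 - (J : ℍ[ℝ]) * I)).add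
          (h2.mul_left (1 + (J : ℍ[ℝ]) * I))).const_smul (1 / 2 : ℝ)
        rw [(hf.affineAt hΩ hqΩ).rep_eq I J]
        refine h3.congr_fun fun k => ?_
        rw [(affineAt_linZPow _ k z).rep_eq I J, rep, smul_mul_assoc, add_mul, mul_assoc, mul_assoc]

/-! ### Adding a sphere of isolated singularities to a domain -/

theorem sphere_inter_slice_subset_closure {Ω : Set ℍ[ℝ]} (hs : IsAxiallySymmetric Ω)
    {I : imagUnits} {x y : ℝ} (h : IsSingularity Ω (cx I ⟨x, y⟩)) (J : imagUnits) :
    sphere x y ∩ slice J ⊆ closure (Ω ∩ slice J) := by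
  have key : ∀ K : imagUnits, slice K = slice J → cx K ⟨x, y⟩ ∈ closure (Ω ∩ slice J) := by
    intro K hK
    have ht : Tendsto (cx K) (𝓝[≠] (⟨x, y⟩ : ℂ)) (𝓝 (cx K ⟨x, y⟩)) :=
      ((continuous_cx K).tendsto _).mono_left nhdsWithin_le_nhds
    refine mem_closure_of_tendsto ht ?_
    filter_upwards [h.eventually] with z hz
    refine ⟨hs.cx_mem hz K, ?_⟩
    rw [← hK, ← range_cx]
    exact mem_range_self _
  rintro q ⟨hq, hJ⟩
  rw [← range_cx] at hJ
  obtain ⟨z, rfl⟩ := hJ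
  rcases mem_sphere_iff.mp hq with rfl | rfl
  · exact key J rfl
  · rw [cx_star]
    refine key _ ?_
    ext q
    rw [← range_cx, ← range_cx]
    constructor <;> rintro ⟨z, rfl⟩ <;> refine ⟨star z, ?_⟩
    · rw [cx_star]
    · rw [← cx_star, star_star]

theorem isOpen_iff_of_symmetric {T : Set ℍ[ℝ]} (hT : IsAxiallySymmetric T) {I : imagUnits}
    (h : IsOpen {z | cx I z ∈ T}) : IsOpen T := by
  have : T = upperCoord ⁻¹' {z | cx I z ∈ T} := by
    ext q; exact hT.mem_iff I q
  rw [this]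
  exact h.preimage continuous_upperCoord

/-- A singularity at one point suffices, since symmetry gives punctured neighborhoods at both points
of the sphere on each line. Connectedness survives because only limit points are added. -/
theorem IsSymmetricSliceDomain.union_sphere {Ω : Set ℍ[ℝ]} (hΩ : IsSymmetricSliceDomain Ω)
    {I : imagUnits} {x y : ℝ} (h : IsSingularity Ω (cx I ⟨x, y⟩)) :
    IsSymmetricSliceDomain (Ω ∪ sphere x y) := by
  have hsym : IsAxiallySymmetric (Ω ∪ sphere x y) :=
    hΩ.symmetric.union (isAxiallySymmetric_sphere x y)
  have hcl : ∀ J : imagUnits, sphere x y ∩ slice J ⊆ closure (Ω ∩ slice J) :=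
    sphere_inter_slice_subset_closure hΩ.symmetric h
  refine ⟨⟨isOpen_iff_of_symmetric hsym (I := I) ?_, ?_, ?_, ?_⟩, hsym⟩
  · set T := {z | cx I z ∈ Ω ∪ sphere x y}
    have h0 : T ∈ 𝓝 (⟨x, y⟩ : ℂ) := by
      refine mem_of_superset (insert_mem_nhds_iff.mpr h.eventually) (insert_subset ?_ ?_)
      · exact Or.inr (mem_sphere_iff.mpr (Or.inl rfl))
      · exact fun z hz => Or.inl hz
    have h1 : T ∈ 𝓝 (star (⟨x, y⟩ : ℂ)) := by
      have h2 : star ⁻¹' T ∈ 𝓝 (star (⟨x, y⟩ : ℂ)) :=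
        (continuous_star.tendsto (star (⟨x, y⟩ : ℂ))) (by rwa [star_star])
      filter_upwards [h2] with z hz
      have := hsym.cx_star_mem (I := I) hz I
      rwa [star_star] at this
    rw [isOpen_iff_mem_nhds]
    rintro z (hz | hz)
    · filter_upwards [(isOpen_cx_preimage hΩ.isOpen I).mem_nhds hz] with w hw
      exact Or.inl hw
    · rcases mem_sphere_iff.mp hz with rfl | rfl
      exacts [h0, h1]
  · refine hΩ.isConnected.subset_closure subset_union_left
      (union_subset subset_closure fun q hq => ?_)
    obtain ⟨J, z, rfl⟩ := exists_cx_eq I q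
    exact closure_mono inter_subset_left (hcl J ⟨hq, by rw [← range_cx]; exact mem_range_self _⟩)
  · obtain ⟨r, hr⟩ := hΩ.meets_real
    exact ⟨r, Or.inl hr⟩
  · intro J hJ
    refine (hΩ.slice_connected J hJ).subset_closure (inter_subset_inter_left _ subset_union_left) ?_
    rw [union_inter_distrib_right]
    exact union_subset subset_closure (hcl ⟨J, hJ⟩)

/-! ### Semiregular functions on a slice -/

theorem RegularOn.analyticAt {f : ℍ[ℝ] → ℍ[ℝ]} {Ω : Set ℍ[ℝ]} (hf : RegularOn f Ω)
    (hΩ : IsOpen Ω) {I : imagUnits} {z : ℂ} (hz : cx I z ∈ Ω) : AnalyticAt ℂ (sliceFn f I) z := by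
  rw [Complex.analyticAt_iff_eventually_differentiableAt]
  filter_upwards [(isOpen_cx_preimage hΩ I).mem_nhds hz] with w hw
  exact (regularOn_iff hΩ).mp hf I w hw

namespace SemiregularOn

variable {f : ℍ[ℝ] → ℍ[ℝ]} {Ω' Ω : Set ℍ[ℝ]} {I : imagUnits} {z : ℂ}

theorem isSingularity (hf : SemiregularOn f Ω' Ω) (hz : cx I z ∈ Ω) : IsSingularity Ω' (cx I z) := by
  by_cases h : cx I z ∈ Ω'
  · exact isSingularity_of_mem hf.domain'.isOpen h
  · rcases hf.pole _ ⟨hz, h⟩ with ⟨m, a, ⟨R, hR, hs, -⟩, -⟩ | ⟨h, -⟩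
    exacts [⟨R, hR, hs⟩, h]

theorem exists_poleLE (hf : SemiregularOn f Ω' Ω) (hz : cx I z ∈ Ω) :
    ∃ m, PoleLE (sliceFn f I) z m := by
  by_cases h : cx I z ∈ Ω'
  · exact ⟨0, poleLE_zero_of_analyticAt (hf.regular.analyticAt hf.domain'.isOpen h)⟩
  · rcases hf.pole _ ⟨hz, h⟩ with ⟨m, hm⟩ | ⟨hs, W, hW, hzW, k, hk, he⟩
    · exact ⟨m, ((poleOrderLE_iff hf.domain' hf.regular).mp hm).2⟩
    · refine ⟨0, (poleLE_zero_of_analyticAt (hk.analyticAt hW hzW)).congr ?_⟩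
      filter_upwards [hs.eventually, eventually_nhdsWithin_of_eventually_nhds
        ((isOpen_cx_preimage hW I).mem_nhds hzW)] with w hw hw'
      rw [sliceFn, sliceFn, he ⟨hw', hw⟩]

/-- Identifies `poleOrder` with the least `m` for which `PoleLE` holds on the line. Minimality is
what later yields the nonvanishing of `g`. -/
theorem exists_poleOrder_eq (hf : SemiregularOn f Ω' Ω) (hz : cx I z ∈ Ω) :
    ∃ m : ℕ, poleOrder f Ω' (cx I z) = m ∧
    PoleLE (sliceFn f I) z m ∧ ∀ k, PoleLE (sliceFn f I) z k → m ≤ k := by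
  classical
  have h := hf.exists_poleLE hz
  have hiff : ∀ k, PoleOrderLE f Ω' (cx I z) k ↔ PoleLE (sliceFn f I) z k := fun k => by
    rw [poleOrderLE_iff hf.domain' hf.regular]
    exact and_iff_right (hf.isSingularity hz)
  refine ⟨Nat.find h, le_antisymm (sInf_le ⟨_, rfl, (hiff _).mpr (Nat.find_spec h)⟩)
    (le_sInf ?_), Nat.find_spec h, fun k hk => Nat.find_min' h hk⟩
  rintro _ ⟨k, rfl, hk⟩
  exact_mod_cast Nat.find_min' h ((hiff k).mp hk)

end SemiregularOn

/-- Transfers poles to the other lines: `rep` commutes with multiplication by `(z - z₀)^m`, by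
`cx_mul_rep`. -/
theorem PoleLE.rep {I : imagUnits} {γ : ℂ → ℍ[ℝ]} {z₀ : ℂ} {m : ℕ}
    (h₁ : PoleLE (fun w => toV I (γ w)) z₀ m) (h₂ : PoleLE (fun w => toV I (γ w)) (star z₀) m)
    (J : imagUnits) : PoleLE (fun w => toV J (rep I J (γ w) (γ (star w)))) z₀ m := by
  obtain ⟨G₁, hG₁, he₁⟩ := h₁
  obtain ⟨G₂, hG₂, he₂⟩ := h₂
  have hstar : Tendsto (fun z : ℂ => star z) (𝓝 z₀) (𝓝 (star z₀)) := continuous_star.tendsto z₀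
  have hstar' : Tendsto (fun z : ℂ => star z) (𝓝[≠] z₀) (𝓝[≠] (star z₀)) :=
    continuous_star.continuousWithinAt.tendsto_nhdsWithin fun z hz h => hz (star_injective h)
  refine ⟨fun z => toV J (SliceRegular.rep I J ((toV I).symm (G₁ z)) ((toV I).symm (G₂ (star z)))),
    ?_, ?_⟩
  · rw [Complex.analyticAt_iff_eventually_differentiableAt] at hG₁ hG₂ ⊢
    filter_upwards [hG₁, hstar.eventually hG₂] with z h₁ h₂
    exact differentiableAt_rep (γ₁ := fun w => (toV I).symm (G₁ w))
      (γ₂ := fun w => (toV I).symm (G₂ w)) h₁ h₂ J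
  · filter_upwards [he₁, hstar'.eventually he₂] with z h₁ h₂
    rw [h₁, h₂, smul_toV, smul_toV, smul_toV, AddEquiv.symm_apply_apply, AddEquiv.symm_apply_apply,
      cx_mul_rep, ← star_sub, ← star_pow]

/-! ### The factorization -/

section factor

variable {f g : ℍ[ℝ] → ℍ[ℝ]} {Ω' Ω : Set ℍ[ℝ]} {I : imagUnits} {z₀ : ℂ} {m n : ℕ}

/-- The restrictions of `f` and `g` to the line `ℝ + Iℝ` satisfy
`g(z) = (z - z₀) ^ m (z - z̄₀) ^ n f(z)` off `z₀` and `z̄₀`. -/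
def IsSliceFactor (f g : ℍ[ℝ] → ℍ[ℝ]) (I : imagUnits) (z₀ : ℂ) (m n : ℕ) : Prop :=
  ∀ z, z ≠ z₀ → z ≠ star z₀ →
    g (cx I z) = cx I ((z - z₀) ^ m * (z - star z₀) ^ n) * f (cx I z)

theorem exists_isSliceFactor (hf : SemiregularOn f Ω' Ω) (hz₀ : cx I z₀ ∈ Ω)
    {G₁ G₂ : ℂ → V I} (hG₁ : AnalyticAt ℂ G₁ z₀)
    (he₁ : ∀ᶠ z in 𝓝[≠] z₀, G₁ z = (z - z₀) ^ m • sliceFn f I z)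
    (hG₂ : AnalyticAt ℂ G₂ (star z₀))
    (he₂ : ∀ᶠ z in 𝓝[≠] (star z₀), G₂ z = (z - star z₀) ^ n • sliceFn f I z) :
    ∃ g, RegularOn g (Ω' ∪ sphere z₀.re z₀.im) ∧ (∀ z, AffineAt g z) ∧
      IsSliceFactor f g I z₀ m n ∧ toV I (g (cx I z₀)) = (z₀ - star z₀) ^ n • G₁ z₀ ∧
      (z₀ ≠ star z₀ → toV I (g (cx I (star z₀))) = (star z₀ - z₀) ^ m • G₂ (star z₀)) := by
  set P : ℂ → ℂ := fun z => (z - z₀) ^ m * (z - star z₀) ^ n with hP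
  set F : ℂ → V I := fun z => P z • sliceFn f I z with hF
  -- The removable singularities are filled with their limits. If `z₀` is real the outer update
  -- prevails, and analyticity at `z̄₀` is that at `z₀`.
  set γ : ℂ → V I := Function.update (Function.update F (star z₀)
    ((star z₀ - z₀) ^ m • G₂ (star z₀))) z₀ ((z₀ - star z₀) ^ n • G₁ z₀) with hγ
  have hγ0 : γ z₀ = (z₀ - star z₀) ^ n • G₁ z₀ := Function.update_self ..
  have hγ1 : z₀ ≠ star z₀ → γ (star z₀) = (star z₀ - z₀) ^ m • G₂ (star z₀) := fun h => by
    rw [hγ, Function.update_of_ne h.symm, Function.update_self]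
  have hγF : ∀ z, z ≠ z₀ → z ≠ star z₀ → γ z = F z := fun z h h' => by
    rw [hγ, Function.update_of_ne h, Function.update_of_ne h']
  have han0 : AnalyticAt ℂ γ z₀ := by
    have h1 : AnalyticAt ℂ (fun z => (z - star z₀) ^ n • G₁ z) z₀ := by fun_prop
    refine h1.congr ?_
    rw [eventually_nhdsWithin_iff] at he₁
    have h2 := eventually_ne_of_nhdsNE z₀ (star z₀)
    rw [eventually_nhdsWithin_iff] at h2
    filter_upwards [he₁, h2] with z hz hz'
    by_cases h : z = z₀
    · rw [h, hγ0]
    · rw [hγF z h (hz' h), hF, hz h, smul_smul, mul_comm]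
  have han1 : AnalyticAt ℂ γ (star z₀) := by
    by_cases h0 : z₀ = star z₀
    · rwa [← h0]
    have h1 : AnalyticAt ℂ (fun z => (z - z₀) ^ m • G₂ z) (star z₀) := by fun_prop
    refine h1.congr ?_
    rw [eventually_nhdsWithin_iff] at he₂
    have h2 := eventually_ne_of_nhdsNE (star z₀) z₀
    rw [eventually_nhdsWithin_iff] at h2
    filter_upwards [he₂, h2] with z hz hz'
    by_cases h : z = star z₀
    · rw [h, hγ1 h0]
    · rw [hγF z (hz' h) h, hF, hz h, smul_smul]
  have hdom := hf.domain'.union_sphere (I := I) (x := z₀.re) (y := z₀.im) (hf.isSingularity hz₀)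
  have hself : ∀ z, toV I (sliceExt I (fun w => (toV I).symm (γ w)) (cx I z)) = γ z := fun z => by
    rw [sliceExt_cx_self, AddEquiv.apply_symm_apply]
  refine ⟨sliceExt I fun z => (toV I).symm (γ z), ?_, AffineAt.of_sliceExt I _, ?_, ?_, ?_⟩
  · refine regularOn_sliceExt hdom.isOpen hdom.symmetric fun z hz => ?_
    change DifferentiableAt ℂ γ z
    by_cases h : z = z₀
    · rw [h]; exact han0.differentiableAt
    by_cases h' : z = star z₀
    · rw [h']; exact han1.differentiableAt
    have hzΩ : cx I z ∈ Ω' := hz.resolve_right fun hs =>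
      (mem_sphere_iff.mp hs).elim h h'
    have hP' : AnalyticAt ℂ P z := by rw [hP]; fun_prop
    have h1 : AnalyticAt ℂ F z :=
      hP'.smul (hf.regular.analyticAt hf.domain'.isOpen hzΩ)
    refine (h1.congr ?_).differentiableAt
    filter_upwards [isOpen_ne.mem_nhds h, isOpen_ne.mem_nhds h'] with w hw hw'
    exact (hγF w hw hw').symm
  · intro z h h'
    apply (toV I).injective
    rw [hself, hγF z h h']
    rfl
  · rw [hself, hγ0]
  · intro h
    rw [hself, hγ1 h]

theorem IsSliceFactor.semiregularOn (hf : SemiregularOn f Ω' Ω) (hz₀ : cx I z₀ ∈ Ω)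
    (hg : RegularOn g (Ω' ∪ sphere z₀.re z₀.im)) (haff : ∀ z, AffineAt g z)
    (hfg : IsSliceFactor f g I z₀ m n) : SemiregularOn g (Ω' ∪ sphere z₀.re z₀.im) Ω := by
  have hdom := hf.domain'.union_sphere (I := I) (x := z₀.re) (y := z₀.im) (hf.isSingularity hz₀)
  refine ⟨hf.domain, hdom, union_subset hf.subset ?_, hg, fun q hq => Or.inl ?_⟩
  · intro q hq
    obtain ⟨J, z, rfl⟩ := exists_cx_eq I q
    rcases mem_sphere_iff.mp hq with h | h
    · rw [h]; exact hf.domain.symmetric.cx_mem hz₀ J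
    · rw [h]; exact hf.domain.symmetric.cx_star_mem hz₀ J
  · obtain ⟨J, w, rfl⟩ := exists_cx_eq I q
    -- On line `I`, `g` is `f` times a polynomial off two points, so its singularities are still
    -- poles. On line `J` the larger of the orders at `w` and `w̄` is a bound.
    have key : ∀ w, cx I w ∈ Ω → ∃ k, PoleLE (sliceFn g I) w k := by
      intro w hw
      obtain ⟨k, hk⟩ := hf.exists_poleLE hw
      refine ⟨k, (hk.smul (u := fun z => (z - z₀) ^ m * (z - star z₀) ^ n) (by fun_prop)).congr ?_⟩
      filter_upwards [eventually_ne_of_nhdsNE w z₀, eventually_ne_of_nhdsNE w (star z₀)]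
        with z h h'
      rw [sliceFn, sliceFn, hfg z h h', smul_toV]
    obtain ⟨k, hk⟩ := key w (hf.domain.symmetric.cx_mem hq.1 I)
    obtain ⟨l, hl⟩ := key (star w) (hf.domain.symmetric.cx_star_mem hq.1 I)
    have h1 := PoleLE.rep (γ := fun z => g (cx I z)) (hk.mono (le_max_left k l))
      (hl.mono (le_max_right k l)) J
    obtain ⟨R, hR, hs⟩ := hf.isSingularity hq.1
    refine ⟨max k l, (poleOrderLE_iff hdom hg).mpr ⟨⟨R, hR, hs.trans subset_union_left⟩, ?_⟩⟩
    refine h1.congr (Eventually.of_forall fun z => ?_)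
    change toV J (SliceRegular.rep I J _ _) = toV J (g (cx J z))
    rw [(haff z).rep_eq I J]

/-! ### The two equalities and the uniqueness of the factor. -/

theorem factor_ne_zero {z : ℂ} (h : z ≠ z₀) (h' : z ≠ star z₀) (m n : ℕ) :
    (z - z₀) ^ m * (z - star z₀) ^ n ≠ 0 :=
  mul_ne_zero (pow_ne_zero _ (sub_ne_zero.mpr h)) (pow_ne_zero _ (sub_ne_zero.mpr h'))

theorem ne_of_notMem_sphere {J : imagUnits} {z : ℂ} (h : cx J z ∉ sphere z₀.re z₀.im) :
    z ≠ z₀ ∧ z ≠ star z₀ ∧ star z ≠ z₀ ∧ star z ≠ star z₀ := by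
  have h1 : z ≠ z₀ := fun h' => h (mem_sphere_iff.mpr (Or.inl h'))
  have h2 : z ≠ star z₀ := fun h' => h (mem_sphere_iff.mpr (Or.inr h'))
  refine ⟨h1, h2, fun h' => h2 ?_, fun h' => h1 (star_injective h')⟩
  rw [← h', star_star]

theorem IsSliceFactor.eq_starMul_poleFactor (hΩ' : IsSymmetricSliceDomain Ω')
    (hf : RegularOn f Ω') (haff : ∀ z, AffineAt g z) (hfg : IsSliceFactor f g I z₀ m n)
    {q : ℍ[ℝ]} (hq : q ∈ Ω' \ sphere z₀.re z₀.im) :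
    f q = starMul (poleFactor (cx I z₀) m n) g q := by
  obtain ⟨J, z, rfl⟩ := exists_cx_eq I q
  obtain ⟨h1, h2, h3, h4⟩ := ne_of_notMem_sphere hq.2
  have key : ∀ z, z ≠ z₀ → z ≠ star z₀ →
      f (cx I z) = starMul (poleFactor (cx I z₀) m n) g (cx I z) := by
    intro z h h'
    rw [starMul_poleFactor_cx I h h', hfg z h h', ← mul_assoc, ← map_mul,
      inv_mul_cancel₀ (factor_ne_zero h h' m n), map_one, one_mul]
  exact (hf.affineAt hΩ' hq.1).eq_of_eq ((affineAt_poleFactor _ m n z).starMul (haff z)) I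
    (key z h1 h2) (key _ h3 h4) J

theorem sub_re_sq_add_im_sq (z₀ z : ℂ) :
    (z - z₀.re) ^ 2 + (z₀.im : ℂ) ^ 2 = (z - z₀) * (z - star z₀) := by
  have e1 : (z₀.re : ℂ) = (z₀ + star z₀) / 2 := Complex.re_eq_add_conj z₀
  have e2 : (z₀.im : ℂ) = (z₀ - star z₀) / (2 * Complex.I) := Complex.im_eq_sub_conj z₀
  rw [e1, e2, div_pow, mul_pow, Complex.I_sq]
  ring

theorem inv_sub_re_sq_add_im_sq_cx (z₀ : ℂ) (n : ℕ) (J : imagUnits) (z : ℂ) :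
    (((cx J z - (z₀.re : ℍ[ℝ])) ^ 2 + (z₀.im : ℍ[ℝ]) ^ 2) ^ n)⁻¹ =
      cx J (((z - z₀) * (z - star z₀)) ^ n)⁻¹ := by
  rw [← sub_re_sq_add_im_sq, map_inv₀, map_pow, map_add, map_pow, map_pow, map_sub, cx_ofReal,
    cx_ofReal]

theorem IsSliceFactor.eq_inv_mul_starMul (hΩ' : IsSymmetricSliceDomain Ω')
    (hf : RegularOn f Ω') (haff : ∀ z, AffineAt g z) (hfg : IsSliceFactor f g I z₀ m n)
    (hmn : m ≤ n) {q : ℍ[ℝ]} (hq : q ∈ Ω' \ sphere z₀.re z₀.im) :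
    f q = (((q - (z₀.re : ℍ[ℝ])) ^ 2 + (z₀.im : ℍ[ℝ]) ^ 2) ^ n)⁻¹ *
      starMul (starPow (fun w => w - cx I z₀) (n - m)) g q := by
  obtain ⟨J, z, rfl⟩ := exists_cx_eq I q
  obtain ⟨h1, h2, h3, h4⟩ := ne_of_notMem_sphere hq.2
  have key : ∀ z, z ≠ z₀ → z ≠ star z₀ →
      f (cx I z) = (((cx I z - (z₀.re : ℍ[ℝ])) ^ 2 + (z₀.im : ℍ[ℝ]) ^ 2) ^ n)⁻¹ *
        starMul (starPow (fun w => w - cx I z₀) (n - m)) g (cx I z) := by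
    intro z h h'
    rw [inv_sub_re_sq_add_im_sq_cx, starMul_of_preserves (starPow_sub_cx I z₀ (n - m)), hfg z h h',
      ← mul_assoc, ← mul_assoc, ← map_mul, ← map_mul]
    -- The power `n - m` raises the exponent of `z - z₀` from `m` to `n`, which gives a power of the
    -- real quadratic polynomial.
    have e : (((z - z₀) * (z - star z₀)) ^ n)⁻¹ * (z - z₀) ^ (n - m) *
        ((z - z₀) ^ m * (z - star z₀) ^ n) = 1 := by
      rw [mul_assoc, ← mul_assoc ((z - z₀) ^ (n - m)), ← pow_add, Nat.sub_add_cancel hmn, ← mul_pow,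
        inv_mul_cancel₀]
      rw [mul_pow]
      exact factor_ne_zero h h' n n
    rw [e, map_one, one_mul]
  exact (hf.affineAt hΩ' hq.1).eq_of_eq (affineAt_cx_mul
    (r := fun q => (((q - (z₀.re : ℍ[ℝ])) ^ 2 + (z₀.im : ℍ[ℝ]) ^ 2) ^ n)⁻¹)
    (fun J => inv_sub_re_sq_add_im_sq_cx z₀ n J z)
    ((affineAt_starPow_sub _ z (n - m)).starMul (haff z))) I (key z h1 h2) (key _ h3 h4) J

theorem IsSliceFactor.eqOn_of_eq_starMul (hf : SemiregularOn f Ω' Ω) (hz₀ : cx I z₀ ∈ Ω)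
    (hg : RegularOn g (Ω' ∪ sphere z₀.re z₀.im)) (haff : ∀ z, AffineAt g z)
    (hfg : IsSliceFactor f g I z₀ m n) {g₁ : ℍ[ℝ] → ℍ[ℝ]} {Ω₁ : Set ℍ[ℝ]}
    (hΩ₁ : IsSymmetricSliceDomain Ω₁) (hg₁ : RegularOn g₁ Ω₁)
    (h : ∀ q ∈ (Ω' ∩ Ω₁) \ sphere z₀.re z₀.im,
      f q = starMul (poleFactor (cx I z₀) m n) g₁ q) :
    EqOn g₁ g (Ω₁ ∩ (Ω' ∪ sphere z₀.re z₀.im)) := by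
  have hdom := hf.domain'.union_sphere (I := I) (x := z₀.re) (y := z₀.im) (hf.isSingularity hz₀)
  have key : ∀ z, cx I z ∈ Ω₁ → cx I z ∈ Ω' ∪ sphere z₀.re z₀.im → z ≠ z₀ → z ≠ star z₀ →
      g₁ (cx I z) = g (cx I z) := by
    intro z h1 h2 h3 h4
    have hs : cx I z ∉ sphere z₀.re z₀.im := fun hs => (mem_sphere_iff.mp hs).elim h3 h4
    rw [hfg z h3 h4, h _ ⟨⟨h2.resolve_right hs, h1⟩, hs⟩, starMul_poleFactor_cx I h3 h4,
      ← mul_assoc, ← map_mul, mul_inv_cancel₀ (factor_ne_zero h3 h4 m n), map_one, one_mul]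
  -- Off `z₀` and `z̄₀` the factor is invertible and both functions equal the same multiple of `f`;
  -- continuity settles the two remaining points.
  have key' : ∀ z, cx I z ∈ Ω₁ → cx I z ∈ Ω' ∪ sphere z₀.re z₀.im →
      g₁ (cx I z) = g (cx I z) := by
    intro z h1 h2
    have c1 := ((hg₁.analyticAt hΩ₁.isOpen h1).continuousAt.tendsto).mono_left
      (nhdsWithin_le_nhds (s := {z}ᶜ))
    have c2 := ((hg.analyticAt hdom.isOpen h2).continuousAt.tendsto).mono_left
      (nhdsWithin_le_nhds (s := {z}ᶜ))
    refine (toV I).injective (tendsto_nhds_unique_of_eventuallyEq c1 c2 ?_)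
    filter_upwards [eventually_ne_of_nhdsNE z z₀, eventually_ne_of_nhdsNE z (star z₀),
      eventually_nhdsWithin_of_eventually_nhds
        ((isOpen_cx_preimage hΩ₁.isOpen I).mem_nhds h1),
      eventually_nhdsWithin_of_eventually_nhds
        ((isOpen_cx_preimage hdom.isOpen I).mem_nhds h2)] with w h3 h4 h5 h6
    rw [sliceFn, sliceFn, key w h5 h6 h3 h4]
  rintro q ⟨h1, h2⟩
  obtain ⟨J, z, rfl⟩ := exists_cx_eq I q
  exact (hg₁.affineAt hΩ₁ h1).eq_of_eq (haff z) I
    (key' z (hΩ₁.symmetric.cx_mem h1 I) (hdom.symmetric.cx_mem h2 I))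
    (key' _ (hΩ₁.symmetric.cx_star_mem h1 I) (hdom.symmetric.cx_star_mem h2 I)) J

theorem map_cx_nhdsNE (I : imagUnits) (z : ℂ) :
    map (cx I) (𝓝[≠] z) = 𝓝[slice I \ {cx I z}] (cx I z) := by
  rw [(isometry_cx I).isEmbedding.map_nhdsWithin_eq, compl_eq_univ_sdiff,
    image_sdiff (cx_injective I), image_univ, range_cx, image_singleton]

theorem tendsto_slice_of_poleLE_zero {G : ℂ → V I} (hG : AnalyticAt ℂ G z₀)
    (he : ∀ᶠ z in 𝓝[≠] z₀, G z = (z - z₀) ^ 0 • sliceFn f I z) (h0 : G z₀ = 0) :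
    Tendsto f (𝓝[slice I \ {cx I z₀}] (cx I z₀)) (𝓝 0) := by
  rw [← map_cx_nhdsNE, tendsto_map'_iff]
  have h1 : Tendsto G (𝓝[≠] z₀) (𝓝 0) := by
    rw [← h0]; exact hG.continuousAt.tendsto.mono_left nhdsWithin_le_nhds
  have h2 : Tendsto (fun z => (toV I).symm (G z)) (𝓝[≠] z₀) (𝓝 0) := by
    have := ((isometry_toV_symm I).continuous.tendsto 0).comp h1
    rwa [map_zero] at this
  refine h2.congr' ?_
  filter_upwards [he] with z hz
  rw [hz, pow_zero, one_smul]
  rfl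

end factor

end

end SliceRegular

/-! ### The main theorem. -/

theorem mainTheorem6
    (Ω Ω' : Set ℍ[ℝ]) (f : ℍ[ℝ] → ℍ[ℝ]) (hf : SliceRegular.SemiregularOn f Ω' Ω)
    (x y : ℝ) (I p : ℍ[ℝ]) (hI : I ∈ SliceRegular.imagUnits)
    (hp : p = (x : ℍ[ℝ]) + I * (y : ℍ[ℝ])) (hpΩ : p ∈ Ω) :
    ∃ m n : ℕ, SliceRegular.poleOrder f Ω' p = (m : ℕ∞) ∧
      SliceRegular.poleOrder f Ω' (star p) = (n : ℕ∞) ∧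
      (m ≤ n →
        -- the local factorization
        (∃ U : Set ℍ[ℝ], SliceRegular.IsSymmetricSliceDomain U ∧ p ∈ U ∧ U ⊆ Ω ∧
          U \ SliceRegular.sphere x y ⊆ Ω' ∧
          ∃ g : ℍ[ℝ] → ℍ[ℝ], SliceRegular.RegularOn g U ∧
            (∀ q ∈ U \ SliceRegular.sphere x y,
              f q = SliceRegular.starMul (SliceRegular.poleFactor p m n) g q ∧
              f q = (((q - (x : ℍ[ℝ])) ^ 2 + (y : ℍ[ℝ]) ^ 2) ^ n)⁻¹ *
                SliceRegular.starMul (SliceRegular.starPow (fun w => w - p) (n - m)) g q) ∧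
            (∀ g₁ : ℍ[ℝ] → ℍ[ℝ], SliceRegular.RegularOn g₁ U →
              (∀ q ∈ U \ SliceRegular.sphere x y,
                f q = SliceRegular.starMul (SliceRegular.poleFactor p m n) g₁ q) →
              EqOn g₁ g U) ∧
            (y ≠ 0 → 0 < n → g (star p) ≠ 0 ∧
              (g p = 0 → m = 0 ∧ Tendsto f (𝓝[SliceRegular.slice I \ {p}] p) (𝓝 0)))) ∧
        -- the global factorization
        (∃ g : ℍ[ℝ] → ℍ[ℝ],
          SliceRegular.SemiregularOn g (Ω' ∪ SliceRegular.sphere x y) Ω ∧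
          (∀ q ∈ Ω' \ SliceRegular.sphere x y,
            f q = SliceRegular.starMul (SliceRegular.poleFactor p m n) g q ∧
            f q = (((q - (x : ℍ[ℝ])) ^ 2 + (y : ℍ[ℝ]) ^ 2) ^ n)⁻¹ *
              SliceRegular.starMul (SliceRegular.starPow (fun w => w - p) (n - m)) g q) ∧
          (∀ (g₁ : ℍ[ℝ] → ℍ[ℝ]) (Ω₁ : Set ℍ[ℝ]), SliceRegular.SemiregularOn g₁ Ω₁ Ω →
            (∀ q ∈ (Ω' ∩ Ω₁) \ SliceRegular.sphere x y,
              f q = SliceRegular.starMul (SliceRegular.poleFactor p m n) g₁ q) →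
            EqOn g₁ g (Ω₁ ∩ (Ω' ∪ SliceRegular.sphere x y))) ∧
          (y ≠ 0 → 0 < n → g (star p) ≠ 0 ∧
            (g p = 0 → m = 0 ∧ Tendsto f (𝓝[SliceRegular.slice I \ {p}] p) (𝓝 0))))) := by
  obtain ⟨z₀, hx, hy⟩ : ∃ z₀ : ℂ, z₀.re = x ∧ z₀.im = y := ⟨⟨x, y⟩, rfl, rfl⟩
  obtain ⟨I, rfl⟩ : ∃ I' : SliceRegular.imagUnits, (I' : ℍ[ℝ]) = I := ⟨⟨I, hI⟩, rfl⟩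
  subst hx hy
  rw [← SliceRegular.cx_apply] at hp
  subst hp
  have hpΩ' := hf.domain.symmetric.cx_star_mem hpΩ I
  obtain ⟨m, hm, hpm, hmin⟩ := hf.exists_poleOrder_eq hpΩ
  obtain ⟨n, hn, hpn, hnin⟩ := hf.exists_poleOrder_eq hpΩ'
  refine ⟨m, n, hm, by rw [SliceRegular.star_cx, hn], fun hmn => ?_⟩
  obtain ⟨G₁, hG₁, he₁⟩ := hpm
  obtain ⟨G₂, hG₂, he₂⟩ := hpn
  obtain ⟨g, hg, haff, hfg, hg0, hg1⟩ :=
    SliceRegular.exists_isSliceFactor hf hpΩ hG₁ he₁ hG₂ he₂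
  have hsemi := hfg.semiregularOn hf hpΩ hg haff
  have hfac : ∀ q ∈ Ω' \ SliceRegular.sphere z₀.re z₀.im,
      f q = SliceRegular.starMul (SliceRegular.poleFactor (SliceRegular.cx I z₀) m n) g q ∧
      f q = (((q - (z₀.re : ℍ[ℝ])) ^ 2 + (z₀.im : ℍ[ℝ]) ^ 2) ^ n)⁻¹ *
        SliceRegular.starMul
          (SliceRegular.starPow (fun w => w - SliceRegular.cx I z₀) (n - m)) g q :=
    fun q hq => ⟨hfg.eq_starMul_poleFactor hf.domain' hf.regular haff hq,
      hfg.eq_inv_mul_starMul hf.domain' hf.regular haff hmn hq⟩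
  have hval : z₀.im ≠ 0 → 0 < n → g (star (SliceRegular.cx I z₀)) ≠ 0 ∧
      (g (SliceRegular.cx I z₀) = 0 → m = 0 ∧ Tendsto f
        (𝓝[SliceRegular.slice I \ {SliceRegular.cx I z₀}] (SliceRegular.cx I z₀)) (𝓝 0)) := by
    intro hy hn0
    -- This makes `g` at each of the two points a nonzero multiple of `G₁ z₀`, respectively `G₂
    -- z̄₀`.
    have hne : z₀ ≠ star z₀ := fun h => hy (Complex.conj_eq_iff_im.mp h.symm)
    constructor
    · intro h0
      have h1 := hg1 hne
      rw [← SliceRegular.star_cx, h0, map_zero] at h1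
      have h2 := (smul_eq_zero.mp h1.symm).resolve_left
        (pow_ne_zero _ (sub_ne_zero.mpr hne.symm))
      obtain ⟨k, rfl⟩ := Nat.exists_eq_succ_of_ne_zero hn0.ne'
      have := hnin k (SliceRegular.PoleLE.of_eq_zero hG₂ he₂ h2)
      omega
    · intro h0
      rw [h0, map_zero] at hg0
      have h2 := (smul_eq_zero.mp hg0.symm).resolve_left (pow_ne_zero _ (sub_ne_zero.mpr hne))
      have hm0 : m = 0 := by
        by_contra hm0
        obtain ⟨k, rfl⟩ := Nat.exists_eq_succ_of_ne_zero hm0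
        have := hmin k (SliceRegular.PoleLE.of_eq_zero hG₁ he₁ h2)
        omega
      subst hm0
      exact ⟨rfl, SliceRegular.tendsto_slice_of_poleLE_zero hG₁ he₁ h2⟩
  -- The global factor also serves for the local statement, with `U` its whole domain of regularity.
  refine ⟨⟨Ω' ∪ SliceRegular.sphere z₀.re z₀.im, hsemi.domain', ?_, hsemi.subset, ?_, g, hg,
    ?_, ?_, hval⟩, g, hsemi, hfac, ?_, hval⟩
  · exact Or.inr (SliceRegular.mem_sphere_iff.mpr (Or.inl rfl))
  · rintro q ⟨hq | hq, hq'⟩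
    exacts [hq, (hq' hq).elim]
  · rintro q ⟨hq | hq, hq'⟩
    exacts [hfac q ⟨hq, hq'⟩, (hq' hq).elim]
  · intro g₁ hg₁ h q hq
    exact hfg.eqOn_of_eq_starMul hf hpΩ hg haff hsemi.domain' hg₁
      (fun q hq => h q ⟨hq.1.2, hq.2⟩) ⟨hq, hq⟩
  · intro g₁ Ω₁ hg₁ h
    exact hfg.eqOn_of_eq_starMul hf hpΩ hg haff hg₁.domain' hg₁.regular h
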